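/- For $\operatorname{Re} a>0$ let $\zeta(s,a)$ denote the Hurwitz zeta function, i.e. the analytic continuation in $s$ to $\mathbb C\setminus\{1\}$ of $\sum_{n\ge 0}(n+a)^{-s}$ ($\operatorname{Re} s>1$), and let $\zeta'(s,a)=\partial_s\zeta(s,a)$. Principal values of powers and logarithms are used throughout, so $(-1)^k=e^{i\pi k}$ for $-1$ as base. Let $t\in\mathbb C$ with $-\pi<\operatorname{Re} t<\pi$ and $t\ne 0$. (1) For every $k\in\mathbb C$ with $\operatorname{Re} k>-3$ the integral $\int_0^\infty \frac{x^k\sinh x\,\sinh 2x}{(\cos t+\cosh 2x)^2}\,dx$ converges absolutely. If moreover $k\neq 0$ and $k$ is not an odd integer, then $$\int_0^\infty \frac{x^k\sinh x\,\sinh 2x}{(\cos t+\cosh 2x)^2}\,dx = R(k,t),$$ where $$R(k,t)=\frac{2^{k-3}e^{i\pi k/2}k\,\pi^k\csc\frac t2}{(-1)^k+1}\Big[\zeta\big(1-k,\tfrac{\pi-t}{4\pi}\big)-\zeta\big(1-k,\tfrac{\pi+t}{4\pi}\big)-\zeta\big(1-k,\tfrac{3\pi-t}{4\pi}\big)+\zeta\big(1-k,\tfrac{3\pi+t}{4\pi}\big)\Big]$$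 $$\qquad+\frac{2^{k-2}e^{i\pi k/2}\pi^{k+1}\sec\frac t2}{(-1)^k+1}\Big[\zeta\big(-k,\tfrac{\pi-t}{4\pi}\big)+\zeta\big(-k,\tfrac{\pi+t}{4\pi}\big)-\zeta\big(-k,\tfrac{3\pi-t}{4\pi}\big)-\zeta\big(-k,\tfrac{3\pi+t}{4\pi}\big)\Big].$$ For every $k_0$ with $\operatorname{Re}k_0>-3$ (in particular for the excluded values), the limit of $R(k,t)$ as $k\to k_0$, $k\neq k_0$, is the integral with $k=k_0$. (2) In the case $k\to 1$, $$\int_0^\infty \frac{x\sinh x\,\sinh 2x}{(\cos t+\cosh 2x)^2}\,dx=\frac{\pi}{2}\sec\frac t2\Big[\zeta'\big(-1,\tfrac{\pi-t}{4\pi}\big)+\zeta'\big(-1,\tfrac{\pi+t}{4\pi}\big)-\zeta'\big(-1,\tfrac{3\pi-t}{4\pi}\big)-\zeta'\big(-1,\tfrac{3\pi+t}{4\pi}\big)\Big]+\frac14\csc\frac t2\,\log\tan\frac{t+\pi}{4}.$$ -/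

import Mathlib

open Complex Set Filter Topology MeasureTheory

/-- `f` is the analytic continuation to `ℂ \ {1}` of the series `∑ n ≥ 0, (n + a) ^ (-s)`,
`Re s > 1`. By the identity theorem `f` is determined by `a` away from `s = 1`. -/
def IsHurwitzContinuation (a : ℂ) (f : ℂ → ℂ) : Prop :=
  DifferentiableOn ℂ f {1}ᶜ ∧
    ∀ s : ℂ, 1 < s.re → HasSum (fun n : ℕ => ((n : ℂ) + a) ^ (-s)) (f s)

open Classical in
/-- The Hurwitz zeta function `ζ(s, a)` of two complex variables, for `Re a > 0` and `s ≠ 1`: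
the analytic continuation in `s` of `∑ n ≥ 0, (n + a) ^ (-s)`, with principal powers.
(Mathlib's `HurwitzZeta.hurwitzZeta` only allows a real parameter, and is periodic in it.) -/
noncomputable def hurwitzZ (s a : ℂ) : ℂ :=
  if h : ∃ f : ℂ → ℂ, IsHurwitzContinuation a f then Classical.choose h s else 0

/-- The derivative `ζ'(s, a) = ∂ζ(s, a)/∂s` in the first argument. -/
noncomputable def hurwitzZDeriv (s a : ℂ) : ℂ :=
  deriv (fun z : ℂ => hurwitzZ z a) s

/-- The integrand `x ^ k * sinh x * sinh 2x / (cos t + cosh 2x) ^ 2`. -/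
noncomputable def hypIntegrand (k t : ℂ) (x : ℝ) : ℂ :=
  (x : ℂ) ^ k * sinh (x : ℂ) * sinh (2 * (x : ℂ)) / (cos t + cosh (2 * (x : ℂ))) ^ 2

/-- The explicit combination of the values `ζ(1 - k, ·)` and `ζ(-k, ·)`. -/
noncomputable def hurwitzSide (k t : ℂ) : ℂ :=
  2 ^ (k - 3) * exp (I * Real.pi * k / 2) * k * (Real.pi : ℂ) ^ k
      / (sin (t / 2) * ((-1 : ℂ) ^ k + 1))
    * (hurwitzZ (1 - k) ((Real.pi - t) / (4 * Real.pi))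
      - hurwitzZ (1 - k) ((t + Real.pi) / (4 * Real.pi))
      - hurwitzZ (1 - k) (3 / 4 - t / (4 * Real.pi))
      + hurwitzZ (1 - k) (1 / 4 * (t / Real.pi + 3)))
  + 2 ^ (k - 2) * exp (I * Real.pi * k / 2) * (Real.pi : ℂ) ^ (k + 1)
      / (cos (t / 2) * ((-1 : ℂ) ^ k + 1))
    * (hurwitzZ (-k) ((Real.pi - t) / (4 * Real.pi))
      + hurwitzZ (-k) ((t + Real.pi) / (4 * Real.pi))
      - hurwitzZ (-k) (3 / 4 - t / (4 * Real.pi))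
      - hurwitzZ (-k) (1 / 4 * (t / Real.pi + 3)))

/-! Put D = cos t + cosh 2x. Since sinh 2x / D² is -1/2 times the derivative of 1/D, integration by
parts turns the integral into half of k ∫ x^(k-1) sinh x / D plus ∫ x^k cosh x / D
(`mellin_sinhMulSinhQuot_eq`). Because D = 2 cos(t/2 + ix) cos(t/2 - ix), these two quotients are
the odd and even parts in x of the secant of t/2 + ix, up to constants. With x = 2πξ the partial
fractions of the secant become series of terms 1/((n + a)² + ξ²), where a runs over the four
arguments in the theorem.

The Mellin transform of 1/(A² + ξ²) at k + 1 is A^(k-1) π / (2 cos(πk/2))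
(`mellin_one_div_sq_add_sq`). Summing over n gives Dirichlet series for Hurwitz zeta values wherever
the exchange converges absolutely (`mellin_tsum_sum_div_sq_add_sq`). For the sinh quotient this is
-1 < Re k < 0. For the cosh quotient the direct exchange converges nowhere, so its value at 0 is
subtracted, which moves the strip to -3 < Re k < -1; adding back a multiple of 1/(1 + ξ²) carries
the result to Re k > -1. The identity theorem then extends everything to Re k > -3
(`mellin_sinhMulSinhQuot`).

Continuation requires ζ(s, a) for complex a. Hermite's formula represents (s - 1) ζ(s, a) as an
explicit entire function `hurwitzEntire`, and uniqueness of continuation identifies it with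
`hurwitzZ` (`hurwitzZ_eq`). All identities are proved with denominators cleared; the excluded k are
zeros of the factors divided out at the end, so there the closed form has removable singularities
and its limits equal the integral.

At k = 1 the factor cos(πk/2) vanishes. Differentiating the cosh identity there produces the ζ'
terms (`mellin_coshQuot_two`), and the sinh integral has an elementary logarithmic primitive
(`mellin_sinhQuot_one`). -/

/-! ### Identity theorem and holomorphic parameter integrals -/

/-- Two holomorphic functions on a preconnected open set agree if they agree on a nonempty open
subset. -/
lemma eqOn_of_eqOn_open {U V : Set ℂ} {f g : ℂ → ℂ} (hU : IsOpen U) (hc : IsPreconnected U)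
    (hf : DifferentiableOn ℂ f U) (hg : DifferentiableOn ℂ g U) (hV : IsOpen V) (hVU : V ⊆ U)
    (hne : V.Nonempty) (h : EqOn f g V) : EqOn f g U := by
  obtain ⟨z, hz⟩ := hne
  exact (hf.analyticOnNhd hU).eqOn_of_preconnected_of_eventuallyEq (hg.analyticOnNhd hU) hc
    (hVU hz) (Filter.eventuallyEq_of_mem (hV.mem_nhds hz) h)

lemma isPreconnected_re_gt (c : ℝ) : IsPreconnected {z : ℂ | c < z.re} :=
  (convex_halfSpace_re_gt c).isPreconnected

lemma isOpen_re_strip (c d : ℝ) : IsOpen {z : ℂ | c < z.re ∧ z.re < d} :=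
  (isOpen_lt continuous_const continuous_re).inter (isOpen_lt continuous_re continuous_const)

lemma isPreconnected_re_strip (c d : ℝ) : IsPreconnected {z : ℂ | c < z.re ∧ z.re < d} :=
  ((convex_halfSpace_re_gt c).inter (convex_halfSpace_re_lt d)).isPreconnected

/-- Holomorphy of `z ↦ ∫ w e^{z ℓ}` at a point with some room for integrability. -/
lemma differentiableAt_integral_mul_exp {α : Type*} [MeasurableSpace α] {μ : Measure α}
    {w ℓ : α → ℂ} (hw : AEStronglyMeasurable w μ) (hl : AEStronglyMeasurable ℓ μ) {z₀ : ℂ} {δ : ℝ}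
    (hδ : 0 < δ)
    (hi : Integrable (fun x => ‖w x‖ * Real.exp ((z₀ * ℓ x).re + δ * ‖ℓ x‖)) μ) :
    DifferentiableAt ℂ (fun z => ∫ x, w x * exp (z * ℓ x) ∂μ) z₀ := by
  have hmeas : ∀ z : ℂ, AEStronglyMeasurable (fun x => w x * exp (z * ℓ x)) μ := fun z =>
    hw.mul (continuous_exp.comp_aestronglyMeasurable (hl.const_mul z))
  have key : ∀ x, ∀ z ∈ Metric.ball z₀ (δ / 2),
      (z * ℓ x).re ≤ (z₀ * ℓ x).re + δ / 2 * ‖ℓ x‖ := by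
    intro x z hz
    have h1 : (z * ℓ x).re = (z₀ * ℓ x).re + ((z - z₀) * ℓ x).re := by
      rw [← add_re]; congr 1; ring
    have h2 : ((z - z₀) * ℓ x).re ≤ ‖z - z₀‖ * ‖ℓ x‖ := (re_le_norm _).trans (norm_mul _ _).le
    have h3 : ‖z - z₀‖ ≤ δ / 2 := by
      rw [Metric.mem_ball, dist_eq_norm] at hz; exact hz.le
    have := mul_le_mul_of_nonneg_right h3 (norm_nonneg (ℓ x))
    linarith
  refine (hasDerivAt_integral_of_dominated_loc_of_deriv_le
    (F := fun z x => w x * exp (z * ℓ x)) (F' := fun z x => w x * (exp (z * ℓ x) * ℓ x))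
    (bound := fun x => 2 / δ * (‖w x‖ * Real.exp ((z₀ * ℓ x).re + δ * ‖ℓ x‖)))
    (Metric.ball_mem_nhds z₀ (half_pos hδ)) (Eventually.of_forall hmeas) ?_ ?_ ?_ ?_ ?_).2.differentiableAt
  · refine hi.mono' (hmeas z₀) (Eventually.of_forall fun x => ?_)
    rw [norm_mul, norm_exp]
    gcongr
    have := norm_nonneg (ℓ x)
    nlinarith
  · exact hw.mul ((continuous_exp.comp_aestronglyMeasurable (hl.const_mul z₀)).mul hl)
  · refine Eventually.of_forall fun x z hz => ?_
    rw [norm_mul, norm_mul, norm_exp]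
    have h1 := key x z hz
    -- Half of δ pays for moving z within the ball; the other half absorbs the factor ℓ produced by
    -- differentiation.
    have h2 : ‖ℓ x‖ ≤ 2 / δ * Real.exp (δ / 2 * ‖ℓ x‖) := by
      have := Real.add_one_le_exp (δ / 2 * ‖ℓ x‖)
      calc ‖ℓ x‖ = 2 / δ * (δ / 2 * ‖ℓ x‖) := by field_simp
        _ ≤ _ := by gcongr; linarith
    calc ‖w x‖ * (Real.exp (z * ℓ x).re * ‖ℓ x‖)
        ≤ ‖w x‖ * (Real.exp ((z₀ * ℓ x).re + δ / 2 * ‖ℓ x‖) *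
          (2 / δ * Real.exp (δ / 2 * ‖ℓ x‖))) := by gcongr
      _ = 2 / δ * (‖w x‖ * (Real.exp ((z₀ * ℓ x).re + δ / 2 * ‖ℓ x‖) *
          Real.exp (δ / 2 * ‖ℓ x‖))) := by ring
      _ = _ := by
        rw [← Real.exp_add, show (z₀ * ℓ x).re + δ / 2 * ‖ℓ x‖ + δ / 2 * ‖ℓ x‖ =
          (z₀ * ℓ x).re + δ * ‖ℓ x‖ by ring]
  · exact hi.const_mul _
  · refine Eventually.of_forall fun x z _ => ?_
    simpa using (((hasDerivAt_id z).mul_const (ℓ x)).cexp).const_mul (w x)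

/-! ### Laplace transforms of powers and Euler's beta integral -/

lemma norm_cpow_mul_exp_neg {t : ℝ} (ht : 0 < t) (s z : ℂ) :
    ‖(t : ℂ) ^ s * exp (-(z * t))‖ = t ^ s.re * Real.exp (-(z.re * t)) := by
  rw [norm_mul, norm_cpow_eq_rpow_re_of_pos ht, norm_exp]
  simp

lemma integrableOn_cpow_mul_exp_neg {s z : ℂ} (hs : 0 < s.re) (hz : 0 < z.re) :
    IntegrableOn (fun t : ℝ => (t : ℂ) ^ (s - 1) * exp (-(z * t))) (Ioi 0) := by
  have h : IntegrableOn (fun t : ℝ => t ^ (s.re - 1) * Real.exp (-(z.re * t))) (Ioi 0) := by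
    have := integrableOn_rpow_mul_exp_neg_mul_rpow (s := s.re - 1) (p := 1) (b := z.re)
      (by linarith) one_pos hz
    simpa using this
  refine h.mono' ?_ ?_
  · refine ContinuousOn.aestronglyMeasurable ?_ measurableSet_Ioi
    refine ContinuousOn.mul ?_ (by fun_prop)
    exact fun t ht => (continuousAt_ofReal_cpow_const _ _ (Or.inr (ne_of_gt ht))).continuousWithinAt
  · filter_upwards [ae_restrict_mem measurableSet_Ioi] with t ht
    rw [norm_cpow_mul_exp_neg ht]
    simp

lemma integral_norm_cpow_mul_exp_neg {s z : ℂ} (hs : 0 < s.re) (hz : 0 < z.re) :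
    ∫ t in Ioi (0 : ℝ), ‖(t : ℂ) ^ (s - 1) * exp (-(z * t))‖ =
      (1 / z.re) ^ s.re * Real.Gamma s.re := by
  rw [← Real.integral_rpow_mul_exp_neg_mul_Ioi hs hz]
  refine setIntegral_congr_fun measurableSet_Ioi fun t ht => ?_
  simp only [norm_cpow_mul_exp_neg (mem_Ioi.1 ht)]
  simp

/-- The Laplace transform of a power, for a complex parameter. -/
lemma integral_cpow_mul_exp_neg {s z : ℂ} (hs : 0 < s.re) (hz : 0 < z.re) :
    ∫ t in Ioi (0 : ℝ), (t : ℂ) ^ (s - 1) * exp (-(z * t)) = z ^ (-s) * Gamma s := by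
  have hf : DifferentiableOn ℂ
      (fun z : ℂ => ∫ t in Ioi (0 : ℝ), (t : ℂ) ^ (s - 1) * exp (z * (-t))) {z | 0 < z.re} := by
    intro z₀ hz₀
    refine (differentiableAt_integral_mul_exp (δ := z₀.re / 2) ?_ (by fun_prop) (half_pos hz₀)
      ?_).differentiableWithinAt
    · refine ContinuousOn.aestronglyMeasurable ?_ measurableSet_Ioi
      exact fun t ht =>
        (continuousAt_ofReal_cpow_const _ _ (Or.inr (ne_of_gt ht))).continuousWithinAt
    · have := (integrableOn_cpow_mul_exp_neg (z := z₀ / 2) hs (by simpa using hz₀)).norm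
      refine this.congr ?_
      filter_upwards [ae_restrict_mem measurableSet_Ioi] with t ht
      have ht' : (0 : ℝ) < t := ht
      rw [norm_mul, norm_exp]
      congr 2
      simp [abs_of_pos ht']
      ring
  have hg : DifferentiableOn ℂ (fun z : ℂ => z ^ (-s) * Gamma s) {z | 0 < z.re} := by
    intro z₀ hz₀
    refine DifferentiableAt.differentiableWithinAt ?_
    exact (differentiableAt_id.cpow_const (Or.inl hz₀)).mul_const _
  have := (hf.analyticOnNhd (isOpen_re_gt 0)).eqOn_of_preconnected_of_frequently_eq
    (hg.analyticOnNhd (isOpen_re_gt 0)) (isPreconnected_re_gt 0) (z₀ := 1) (by simp) ?_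
  · have h := this hz
    simp only [mul_neg] at h
    exact h
  · have hr : ∀ r : ℝ, 0 < r → ∫ t in Ioi (0 : ℝ), (t : ℂ) ^ (s - 1) * exp (r * (-t)) =
        (r : ℂ) ^ (-s) * Gamma s := by
      intro r hr
      have := Complex.integral_cpow_mul_exp_neg_mul_Ioi hs hr
      simp only [mul_neg, this]
      congr 1
      rw [cpow_neg, one_div, inv_cpow]
      rw [arg_ofReal_of_nonneg hr.le]; exact Real.pi_pos.ne
    -- The formula is known for positive reals, and these points accumulate at 1, which suffices for
    -- the identity theorem.
    have ht : Tendsto (fun n : ℕ => ((1 + 1 / ((n : ℝ) + 1) : ℝ) : ℂ)) atTop (𝓝[≠] 1) := by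
      refine tendsto_nhdsWithin_iff.2 ⟨?_, Eventually.of_forall fun n => ?_⟩
      · have := tendsto_one_div_add_atTop_nhds_zero_nat (𝕜 := ℝ)
        have := (continuous_ofReal.tendsto _).comp (this.const_add 1)
        simpa [Function.comp_def] using this
      · simp only [mem_compl_iff, mem_singleton_iff]
        norm_cast
        have : (0 : ℝ) < 1 / ((n : ℝ) + 1) := by positivity
        push_cast at *
        linarith
    refine ht.frequently (Eventually.frequently (Eventually.of_forall fun n => ?_))
    exact hr _ (by positivity)

lemma ofReal_mul_cpow {r : ℝ} (hr : 0 < r) {z : ℂ} (hz : z ≠ 0) (s : ℂ) :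
    ((r : ℂ) * z) ^ s = (r : ℂ) ^ s * z ^ s := by
  have hr' : (r : ℂ) ≠ 0 := ofReal_ne_zero.2 hr.ne'
  rw [cpow_def_of_ne_zero (mul_ne_zero hr' hz), cpow_def_of_ne_zero hr', cpow_def_of_ne_zero hz,
    log_ofReal_mul hr hz, ofReal_log hr.le, ← exp_add]
  ring_nf

lemma inv_re_pos {z : ℂ} (hz : 0 < z.re) : 0 < (z⁻¹).re := by
  rw [inv_re]
  have := ne_zero_of_re_pos hz
  exact div_pos hz (normSq_pos.2 this)

lemma arg_ne_pi_of_re_pos {z : ℂ} (hz : 0 < z.re) : z.arg ≠ Real.pi := by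
  intro h
  have := (arg_eq_pi_iff.1 h).1
  linarith

/-- Euler's beta integral `∫ y ^ (p - 1) / (α + β y)` over the half-line. -/
lemma integral_cpow_div_add_mul {p α β : ℂ} (hp0 : 0 < p.re) (hp1 : p.re < 1) (hα : 0 < α.re)
    (hβ : 0 < β.re) :
    ∫ y in Ioi (0 : ℝ), (y : ℂ) ^ (p - 1) / (α + β * y) =
      α ^ (p - 1) * β ^ (-p) * (Gamma p * Gamma (1 - p)) := by
  set ν : Measure ℝ := volume.restrict (Ioi 0) with hν
  -- Writing 1/(α + βy) as the integral of e^(-u(α + βy)) over u > 0 gives a double integral,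
  -- evaluated in both orders.
  set F : ℝ → ℝ → ℂ := fun u y => exp (-(α * u)) * ((y : ℂ) ^ (p - 1) * exp (-((u * β) * y)))
    with hF
  have hzre : ∀ u : ℝ, 0 < u → 0 < ((u : ℂ) * β).re := fun u hu => by
    rw [re_ofReal_mul]; positivity
  have hmeas : AEStronglyMeasurable (Function.uncurry F) (ν.prod ν) := by
    refine Measurable.aestronglyMeasurable ?_
    simp only [hF, Function.uncurry_def]
    fun_prop
  have hnorm : ∀ u : ℝ, 0 < u → ∫ y, ‖F u y‖ ∂ν =
      (1 / β.re) ^ p.re * Real.Gamma p.re * (u ^ (-p.re) * Real.exp (-(α.re * u))) := by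
    intro u hu
    have h := integral_norm_cpow_mul_exp_neg (s := p) hp0 (hzre u hu)
    simp only [hF, norm_mul (exp (-(α * (u : ℂ))))]
    rw [integral_const_mul, h, norm_exp, re_ofReal_mul, one_div, mul_inv,
      Real.mul_rpow (by positivity) (by positivity), Real.rpow_neg hu.le, Real.inv_rpow hu.le]
    simp
    ring
  have hint : Integrable (Function.uncurry F) (ν.prod ν) := by
    rw [integrable_prod_iff hmeas]
    constructor
    · filter_upwards [ae_restrict_mem measurableSet_Ioi] with u hu
      exact Integrable.const_mul (integrableOn_cpow_mul_exp_neg (s := p) hp0 (hzre u hu)) (exp (-(α * u)))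
    · have h := (integrableOn_cpow_mul_exp_neg (s := 1 - p) (z := α) (by simpa using hp1) hα).norm
      refine (h.const_mul ((1 / β.re) ^ p.re * Real.Gamma p.re)).congr ?_
      filter_upwards [ae_restrict_mem measurableSet_Ioi] with u hu
      simp only [Function.uncurry_apply_pair]
      rw [hnorm u hu, norm_cpow_mul_exp_neg hu]
      simp
  have h1 : ∫ u, ∫ y, F u y ∂ν ∂ν = α ^ (p - 1) * β ^ (-p) * (Gamma p * Gamma (1 - p)) := by
    have : ∫ u, ∫ y, F u y ∂ν ∂ν = ∫ u in Ioi (0 : ℝ), β ^ (-p) * Gamma p *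
        ((u : ℂ) ^ ((1 - p) - 1) * exp (-(α * u))) := by
      refine setIntegral_congr_fun measurableSet_Ioi fun u hu => ?_
      simp only [hF]
      rw [integral_const_mul, integral_cpow_mul_exp_neg hp0 (hzre u hu),
        ofReal_mul_cpow hu (ne_zero_of_re_pos hβ)]
      ring_nf
    rw [this, integral_const_mul, integral_cpow_mul_exp_neg (by simpa using hp1) hα]
    ring_nf
  have h2 : ∫ y, ∫ u, F u y ∂ν ∂ν = ∫ y in Ioi (0 : ℝ), (y : ℂ) ^ (p - 1) / (α + β * y) := by
    refine setIntegral_congr_fun measurableSet_Ioi fun y hy => ?_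
    have hre : 0 < (α + β * y).re := by
      rw [add_re, re_mul_ofReal]
      have := mul_pos hβ (mem_Ioi.1 hy)
      linarith
    have h3 := integral_cpow_mul_exp_neg (s := 1) (z := α + β * y) (by simp) hre
    simp only [sub_self, cpow_zero, one_mul, Gamma_one, mul_one, cpow_neg_one] at h3
    rw [div_eq_mul_inv, ← h3, ← integral_const_mul]
    refine integral_congr_ae (Eventually.of_forall fun u => ?_)
    simp only [hF]
    rw [mul_left_comm, ← exp_add]
    ring_nf
  rw [← h2, ← h1, integral_integral_swap hint]

/-! ### Mellin transform of 1/(A² + x²) -/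

/-- The Mellin transform of `1 / (A ^ 2 + x ^ 2)` in terms of `Γ`. -/
lemma mellin_one_div_sq_add_sq_gamma {A k : ℂ} (hA : 0 < A.re) (hk1 : -1 < k.re)
    (hk2 : k.re < 1) :
    mellin (fun x : ℝ => 1 / (A ^ 2 + (x : ℂ) ^ 2)) (k + 1) =
      A ^ (k - 1) * (Gamma ((k + 1) / 2) * Gamma (1 - (k + 1) / 2) / 2) := by
  have hA0 := ne_zero_of_re_pos hA
  have h2 : ((k + 1) / 2).re = (k.re + 1) / 2 := by
    rw [show (k + 1) / 2 = ((1 / 2 : ℝ) : ℂ) * (k + 1) by push_cast; ring, re_ofReal_mul]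
    simp; ring
  -- A² may leave the right half-plane, but A² + y = A (A + A⁻¹ y), and both A and A⁻¹ stay inside
  -- it.
  have hb := integral_cpow_div_add_mul (p := (k + 1) / 2) (α := A) (β := A⁻¹) (by rw [h2]; linarith)
    (by rw [h2]; linarith) hA (inv_re_pos hA)
  have hm := mellin_comp_rpow (fun y : ℝ => 1 / (A ^ 2 + (y : ℂ))) (k + 1) 2
  have hL : mellin (fun x : ℝ => 1 / (A ^ 2 + (x : ℂ) ^ 2)) (k + 1) =
      mellin (fun t : ℝ => 1 / (A ^ 2 + ((t ^ (2 : ℝ) : ℝ) : ℂ))) (k + 1) := by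
    unfold mellin
    refine setIntegral_congr_fun measurableSet_Ioi fun t ht => ?_
    simp
  rw [hL, hm]
  have hR : mellin (fun y : ℝ => 1 / (A ^ 2 + (y : ℂ))) ((k + 1) / 2) = A⁻¹ *
      ∫ y in Ioi (0 : ℝ), (y : ℂ) ^ ((k + 1) / 2 - 1) / (A + A⁻¹ * y) := by
    unfold mellin
    rw [← integral_const_mul]
    refine setIntegral_congr_fun measurableSet_Ioi fun y hy => ?_
    simp only [smul_eq_mul]
    rw [show A ^ 2 + (y : ℂ) = A * (A + A⁻¹ * y) by field_simp, one_div, mul_inv]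
    ring
  push_cast
  rw [hR, hb, inv_cpow _ _ (arg_ne_pi_of_re_pos hA), ← cpow_neg, neg_neg]
  have : A⁻¹ * (A ^ ((k + 1) / 2 - 1) * A ^ ((k + 1) / 2)) = A ^ (k - 1) := by
    rw [← cpow_neg_one, ← cpow_add _ _ hA0, ← cpow_add _ _ hA0]
    congr 1; ring
  rw [← this]
  simp
  ring

/-- Both factors of A² + x² = (A + ix)(A - ix) are comparable to the real case as long as A stays in
a fixed sector of slope τ. -/
lemma norm_sq_add_sq_ge {A : ℂ} (hA : 0 < A.re) {τ : ℝ} (hτ : |A.im| ≤ τ * A.re) (x : ℝ) :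
    (A.re ^ 2 + x ^ 2) / (2 + 2 * τ ^ 2) ≤ ‖A ^ 2 + (x : ℂ) ^ 2‖ := by
  have hc : 0 < 2 + 2 * τ ^ 2 := by positivity
  have hm : A.im ^ 2 ≤ τ ^ 2 * A.re ^ 2 := by
    rw [← sq_abs, ← mul_pow]; exact pow_le_pow_left₀ (abs_nonneg _) hτ 2
  have key : ∀ y : ℝ, y ^ 2 = x ^ 2 →
      (A.re ^ 2 + x ^ 2) / (2 + 2 * τ ^ 2) ≤ ‖A + y * I‖ ^ 2 := by
    intro y hy
    rw [div_le_iff₀ hc, Complex.sq_norm, normSq_apply]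
    simp only [add_re, add_im, mul_re, mul_im, ofReal_re, ofReal_im, I_re, I_im]
    -- With b = Im A: 2(b + y)² + 2b² - y² = (2b + y)², and b² ≤ τ² (Re A)².
    nlinarith [sq_nonneg (2 * A.im + y), mul_nonneg (sq_nonneg τ) (sq_nonneg (A.im + y)),
      sq_nonneg (A.re), mul_nonneg (sq_nonneg τ) (sq_nonneg A.re)]
  have h1 := key x rfl
  have h2 := key (-x) (by ring)
  have hfac : A ^ 2 + (x : ℂ) ^ 2 = (A + x * I) * (A + ((-x : ℝ) : ℂ) * I) := by
    push_cast; linear_combination ((x : ℂ) ^ 2) * I_sq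
  rw [hfac, norm_mul]
  set q := (A.re ^ 2 + x ^ 2) / (2 + 2 * τ ^ 2)
  have hq : 0 ≤ q := by positivity
  refine abs_le_of_sq_le_sq' ?_ (by positivity) |>.2
  rw [mul_pow, sq]
  exact mul_le_mul h1 h2 hq (by positivity)

/-- A divergent Bochner integral has value 0, whereas the Gamma formula, which was derived without
assuming convergence, gives a nonzero value. -/
lemma mellinConvergent_one_div_sq_add_sq {A k : ℂ} (hA : 0 < A.re) (hk1 : -1 < k.re)
    (hk2 : k.re < 1) :
    MellinConvergent (fun x : ℝ => 1 / (A ^ 2 + (x : ℂ) ^ 2)) (k + 1) := by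
  by_contra hcon
  have h := mellin_one_div_sq_add_sq_gamma hA hk1 hk2
  have h0 : mellin (fun x : ℝ => 1 / (A ^ 2 + (x : ℂ) ^ 2)) (k + 1) = 0 := integral_undef hcon
  have h2 : ((k + 1) / 2).re = (k.re + 1) / 2 := by
    rw [show (k + 1) / 2 = ((1 / 2 : ℝ) : ℂ) * (k + 1) by push_cast; ring, re_ofReal_mul]
    simp; ring
  rw [h0] at h
  refine mul_ne_zero ?_ (div_ne_zero (mul_ne_zero ?_ ?_) two_ne_zero) h.symm
  · exact fun h' => ne_zero_of_re_pos hA ((cpow_eq_zero_iff _ _).1 h').1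
  · exact Gamma_ne_zero_of_re_pos (by rw [h2]; linarith)
  · exact Gamma_ne_zero_of_re_pos (by rw [sub_re, h2, one_re]; linarith)

/-- The Mellin transform of `1 / (A ^ 2 + x ^ 2)`. -/
lemma mellin_one_div_sq_add_sq {A k : ℂ} (hA : 0 < A.re) (hk1 : -1 < k.re) (hk2 : k.re < 1) :
    mellin (fun x : ℝ => 1 / (A ^ 2 + (x : ℂ) ^ 2)) (k + 1) =
      A ^ (k - 1) * (Real.pi / (2 * cos (Real.pi * k / 2))) := by
  rw [mellin_one_div_sq_add_sq_gamma hA hk1 hk2, Gamma_mul_Gamma_one_sub,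
    show (Real.pi : ℂ) * ((k + 1) / 2) = Real.pi * k / 2 + Real.pi / 2 by ring, sin_add_pi_div_two]
  congr 1
  rw [div_div, mul_comm (2 : ℂ)]

/-- Comparison with the real parameter Re A and real exponent Re k, where the integrand is its own
norm and its integral is known; the sector constant is the price. -/
lemma integral_norm_mellin_one_div_sq_add_sq_le {A k : ℂ} (hA : 0 < A.re) {τ : ℝ}
    (hτ : |A.im| ≤ τ * A.re) (hk1 : -1 < k.re) (hk2 : k.re < 1) :
    ∫ x in Ioi (0 : ℝ), ‖(x : ℂ) ^ (k + 1 - 1) • (1 / (A ^ 2 + (x : ℂ) ^ 2))‖ ≤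
      (2 + 2 * τ ^ 2) * ‖(Gamma (((k.re : ℂ) + 1) / 2) * Gamma (1 - ((k.re : ℂ) + 1) / 2) / 2)‖ *
        A.re ^ (k.re - 1) := by
  have hc : 0 < 2 + 2 * τ ^ 2 := by positivity
  have hconv := mellinConvergent_one_div_sq_add_sq (A := (A.re : ℂ)) (k := (k.re : ℂ)) (by simpa)
    (by simpa) (by simpa)
  have hval := mellin_one_div_sq_add_sq_gamma (A := (A.re : ℂ)) (k := (k.re : ℂ)) (by simpa)
    (by simpa) (by simpa)
  have hpt : ∀ x ∈ Ioi (0 : ℝ), ((x : ℂ) ^ ((k.re : ℂ) + 1 - 1) •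
      (1 / ((A.re : ℂ) ^ 2 + (x : ℂ) ^ 2))) = ((x ^ k.re * (1 / (A.re ^ 2 + x ^ 2)) : ℝ) : ℂ) := by
    intro x hx
    push_cast [ofReal_cpow (le_of_lt (mem_Ioi.1 hx))]
    simp
  have hint : IntegrableOn (fun x : ℝ => x ^ k.re * (1 / (A.re ^ 2 + x ^ 2))) (Ioi 0) := by
    exact (hconv.congr_fun hpt measurableSet_Ioi).re
  have hval' : ∫ x in Ioi (0 : ℝ), x ^ k.re * (1 / (A.re ^ 2 + x ^ 2)) =
      ‖(Gamma (((k.re : ℂ) + 1) / 2) * Gamma (1 - ((k.re : ℂ) + 1) / 2) / 2)‖ *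
        A.re ^ (k.re - 1) := by
    rw [mellin, setIntegral_congr_fun measurableSet_Ioi hpt, integral_complex_ofReal] at hval
    have h := congrArg norm hval
    rw [norm_real, Real.norm_of_nonneg, norm_mul, norm_cpow_eq_rpow_re_of_pos hA] at h
    · rw [h]; simp [mul_comm]
    · exact setIntegral_nonneg measurableSet_Ioi fun x hx => by
        have := mem_Ioi.1 hx; positivity
  rw [mul_assoc, ← hval', ← integral_const_mul]
  refine setIntegral_mono_on (mellinConvergent_one_div_sq_add_sq hA hk1 hk2).norm
    (hint.const_mul _) measurableSet_Ioi fun x hx => ?_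
  have hx' := mem_Ioi.1 hx
  have hb := norm_sq_add_sq_ge hA hτ x
  have hp : 0 < (A.re ^ 2 + x ^ 2) / (2 + 2 * τ ^ 2) := by positivity
  rw [norm_smul, norm_cpow_eq_rpow_re_of_pos hx', norm_div, norm_one]
  simp only [add_sub_cancel_right]
  calc x ^ k.re * (1 / ‖A ^ 2 + (x : ℂ) ^ 2‖)
      ≤ x ^ k.re * (1 / ((A.re ^ 2 + x ^ 2) / (2 + 2 * τ ^ 2))) := by gcongr
    _ = _ := by field_simp

/-! ### Exchange of sum and Mellin transform -/

/-- Termwise Mellin transform of `∑ₙ ∑ᵢ cᵢₙ / ((n + aᵢ) ^ 2 + x ^ 2)`. -/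
lemma mellin_tsum_sum_div_sq_add_sq {ι : Type*} [Fintype ι] {a : ι → ℂ} (ha : ∀ i, 0 < (a i).re)
    {c : ι → ℕ → ℂ} {k : ℂ} (hk1 : -1 < k.re) (hk2 : k.re < 1)
    (hc : ∀ i, Summable fun n : ℕ => ‖c i n‖ * ((n : ℝ) + (a i).re) ^ (k.re - 1)) :
    mellin (fun x : ℝ => ∑' n : ℕ, ∑ i, c i n / (((n : ℂ) + a i) ^ 2 + (x : ℂ) ^ 2)) (k + 1) =
      (∑ i, ∑' n : ℕ, c i n * ((n : ℂ) + a i) ^ (k - 1)) *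
        (Real.pi / (2 * cos (Real.pi * k / 2))) := by
  have hre : ∀ i (n : ℕ), ((n : ℂ) + a i).re = n + (a i).re := fun i n => by simp
  have hpos : ∀ i (n : ℕ), 0 < ((n : ℂ) + a i).re := fun i n => by
    rw [hre]; have := ha i; positivity
  set g : ι → ℕ → ℝ → ℂ := fun i n x =>
    (x : ℂ) ^ (k + 1 - 1) • (1 / (((n : ℂ) + a i) ^ 2 + (x : ℂ) ^ 2)) with hg
  have hgi : ∀ i n, IntegrableOn (g i n) (Ioi 0) := fun i n =>
    mellinConvergent_one_div_sq_add_sq (hpos i n) hk1 hk2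
  set F : ℕ → ℝ → ℂ := fun n x => ∑ i, c i n * g i n x with hF
  have hFi : ∀ n, IntegrableOn (F n) (Ioi 0) := fun n =>
    integrable_finsetSum _ fun i _ => (hgi i n).const_mul _
  set C : ℝ := ‖(Gamma (((k.re : ℂ) + 1) / 2) * Gamma (1 - ((k.re : ℂ) + 1) / 2) / 2)‖
  -- The slope of `a i` serves for every n: the shift keeps the imaginary part and enlarges the real
  -- part.
  set τ : ι → ℝ := fun i => |(a i).im| / (a i).re
  have hgn : ∀ i n, ∫ x in Ioi (0 : ℝ), ‖g i n x‖ ≤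
      (2 + 2 * τ i ^ 2) * C * ((n : ℝ) + (a i).re) ^ (k.re - 1) := by
    intro i n
    rw [← hre i n]
    refine integral_norm_mellin_one_div_sq_add_sq_le (hpos i n) ?_ hk1 hk2
    rw [hre]
    have h1 : |((n : ℂ) + a i).im| = τ i * (a i).re := by
      simp only [τ]; rw [div_mul_cancel₀ _ (ha i).ne']; simp
    rw [h1]
    have : 0 ≤ τ i := div_nonneg (abs_nonneg _) (ha i).le
    exact mul_le_mul_of_nonneg_left (by linarith [Nat.cast_nonneg (α := ℝ) n]) this
  have hsum : Summable fun n => ∫ x in Ioi (0 : ℝ), ‖F n x‖ := by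
    have hS : Summable fun n : ℕ => ∑ i, (2 + 2 * τ i ^ 2) * C *
        (‖c i n‖ * ((n : ℝ) + (a i).re) ^ (k.re - 1)) :=
      summable_sum fun i _ => (hc i).mul_left _
    refine Summable.of_nonneg_of_le (fun n => integral_nonneg fun x => norm_nonneg _) (fun n => ?_) hS
    calc ∫ x in Ioi (0 : ℝ), ‖F n x‖ ≤ ∫ x in Ioi (0 : ℝ), ∑ i, ‖c i n‖ * ‖g i n x‖ := by
          refine integral_mono (hFi n).norm
            (integrable_finsetSum _ fun i _ => (hgi i n).norm.const_mul _) fun x => ?_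
          refine (norm_sum_le _ _).trans (Finset.sum_le_sum fun i _ => (norm_mul _ _).le)
      _ = ∑ i, ‖c i n‖ * ∫ x in Ioi (0 : ℝ), ‖g i n x‖ := by
          rw [integral_finsetSum _ fun i _ => (hgi i n).norm.const_mul _]
          simp only [integral_const_mul]
      _ ≤ _ := by
          refine Finset.sum_le_sum fun i _ => ?_
          calc _ ≤ ‖c i n‖ * ((2 + 2 * τ i ^ 2) * C * ((n : ℝ) + (a i).re) ^ (k.re - 1)) := by
                gcongr; exact hgn i n
            _ = _ := by ring
  -- A complex exponent costs only the factor e^(π |Im k|), since arguments are bounded by π.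
  have hcs : ∀ i, Summable fun n : ℕ => c i n * ((n : ℂ) + a i) ^ (k - 1) := by
    intro i
    refine Summable.of_norm_bounded_eventually_nat
      (g := fun n : ℕ => Real.exp (Real.pi * |k.im|) *
        (‖c i n‖ * (‖(n : ℂ) + a i‖ ^ (k.re - 1)))) ?_ ?_
    · refine Summable.mul_left _ ?_
      refine Summable.of_nonneg_of_le (fun n => by positivity) (fun n => ?_) (hc i)
      gcongr ‖c i n‖ * ?_
      refine Real.rpow_le_rpow_of_nonpos ?_ ?_ (by linarith)
      · have := hpos i n; rwa [hre] at this
      · rw [← hre]; exact re_le_norm _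
    · refine Eventually.of_forall fun n => ?_
      rw [norm_mul, norm_cpow_of_ne_zero (ne_zero_of_re_pos (hpos i n)), div_eq_mul_inv,
        ← Real.exp_neg]
      have : -(((n : ℂ) + a i).arg * (k - 1).im) ≤ Real.pi * |k.im| := by
        have h1 := abs_arg_le_pi ((n : ℂ) + a i)
        have h2 : (k - 1).im = k.im := by simp
        rw [h2]
        calc _ ≤ |((n : ℂ) + a i).arg * k.im| := neg_le_abs _
          _ = |((n : ℂ) + a i).arg| * |k.im| := abs_mul _ _
          _ ≤ _ := by gcongr
      have h3 : (k - 1).re = k.re - 1 := by simp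
      rw [h3]
      calc _ ≤ ‖c i n‖ * (‖(n : ℂ) + a i‖ ^ (k.re - 1) * Real.exp (Real.pi * |k.im|)) := by
            gcongr
        _ = _ := by ring
  have hmain := hasSum_integral_of_summable_integral_norm hFi hsum
  have hL : mellin (fun x : ℝ => ∑' n : ℕ, ∑ i, c i n / (((n : ℂ) + a i) ^ 2 + (x : ℂ) ^ 2)) (k + 1)
      = ∫ x in Ioi (0 : ℝ), ∑' n, F n x := by
    unfold mellin
    refine setIntegral_congr_fun measurableSet_Ioi fun x _ => ?_
    simp only [smul_eq_mul, hF, hg]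
    rw [← tsum_mul_left]
    refine tsum_congr fun n => ?_
    rw [Finset.mul_sum]
    exact Finset.sum_congr rfl fun i _ => by ring
  rw [hL, ← hmain.tsum_eq, ← Summable.tsum_finsetSum fun i _ => hcs i, ← tsum_mul_right]
  refine tsum_congr fun n => ?_
  rw [hF, integral_finsetSum _ fun i _ => (hgi i n).const_mul _, Finset.sum_mul]
  refine Finset.sum_congr rfl fun i _ => ?_
  rw [integral_const_mul, mul_assoc, ← mellin_one_div_sq_add_sq (hpos i n) hk1 hk2]
  rfl

/-! ### Partial fractions of the cotangent and of 1/(1 - e⁻ᵘ) -/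

lemma summable_one_div_natCast_add_mul (z w : ℂ) :
    Summable fun n : ℕ => 1 / (((n : ℂ) + z) * ((n : ℂ) + w)) := by
  have hO : ∀ z : ℂ, (fun n : ℕ => ((n : ℂ) + z)⁻¹) =O[atTop] fun n : ℕ => ((n : ℝ))⁻¹ := by
    intro z
    refine Asymptotics.IsBigO.of_bound 2 ?_
    filter_upwards [eventually_ge_atTop (Nat.ceil (2 * ‖z‖) + 1)] with n hn
    have h1 : 2 * ‖z‖ ≤ n := (Nat.le_ceil _).trans (by exact_mod_cast (by omega : _ ≤ n))
    have h2 : (0 : ℝ) < n := by exact_mod_cast (by omega : 0 < n)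
    have h3 : (n : ℝ) / 2 ≤ ‖(n : ℂ) + z‖ := by
      have := norm_sub_le ((n : ℂ) + z) z
      simp only [add_sub_cancel_right, norm_natCast] at this
      linarith
    rw [norm_inv, norm_inv, Real.norm_of_nonneg h2.le]
    calc ‖(n : ℂ) + z‖⁻¹ ≤ ((n : ℝ) / 2)⁻¹ := by gcongr
      _ = _ := by rw [inv_div]; ring
  refine summable_of_isBigO_nat (Real.summable_nat_pow_inv.2 one_lt_two) (f := fun n : ℕ =>
    1 / (((n : ℂ) + z) * ((n : ℂ) + w))) ?_
  refine ((hO z).mul (hO w)).congr (fun n => ?_) (fun n => ?_)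
  · rw [one_div, mul_inv]
  · rw [sq, mul_inv]

/-- The partial fraction expansion of `π cot (π x)`, indexed by `ℕ`. -/
lemma hasSum_pi_mul_cot {x : ℂ} (hx : x ∈ integerComplement) :
    HasSum (fun n : ℕ => 1 / ((n : ℂ) + x) - 1 / ((n : ℂ) + 1 - x))
      (Real.pi * cot (Real.pi * x)) := by
  have h1 := (summable_cotTerm hx).hasSum
  have h2 : ∑' n, cotTerm x n = Real.pi * cot (Real.pi * x) - 1 / x := (cot_series_rep' hx).symm
  rw [h2] at h1
  have hnorm : Tendsto (fun n : ℕ => 1 / ((n : ℂ) + x)) atTop (𝓝 0) := by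
    simp only [one_div]
    refine tendsto_inv₀_cobounded.comp ?_
    refine (tendsto_add_const_cobounded x).comp tendsto_natCast_atTop_cobounded
  -- The cotangent series pairs x + (n + 1) with x - (n + 1) and leaves 1/x apart; this telescoping
  -- series, of sum 1/x, shifts the first family by one index.
  have hlim : Tendsto (fun N : ℕ => ∑ n ∈ Finset.range N,
      (1 / ((n : ℂ) + x) - 1 / (((n + 1 : ℕ) : ℂ) + x))) atTop (𝓝 (1 / x)) := by
    have : ∀ N : ℕ, ∑ n ∈ Finset.range N, (1 / ((n : ℂ) + x) - 1 / (((n + 1 : ℕ) : ℂ) + x)) =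
        1 / x - 1 / ((N : ℂ) + x) := by
      intro N
      rw [Finset.sum_range_sub' (fun n : ℕ => 1 / ((n : ℂ) + x))]; simp
    simp only [this]
    simpa using hnorm.const_sub (1 / x)
  have hterm : ∀ n : ℕ, 1 / ((n : ℂ) + x) - 1 / ((n : ℂ) + 1 - x) =
      (1 / ((n : ℂ) + x) - 1 / (((n + 1 : ℕ) : ℂ) + x)) + cotTerm x n := by
    intro n
    have : 1 / (x - ((n : ℂ) + 1)) = - (1 / ((n : ℂ) + 1 - x)) := by
      rw [← one_div_neg_eq_neg_one_div]; ring_nf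
    simp only [cotTerm]
    rw [this]; push_cast; ring_nf
  have hne : ∀ n : ℕ, (n : ℂ) + x ≠ 0 := fun n h' =>
    hx ⟨-n, by push_cast; linear_combination -h'⟩
  have hs : Summable fun n : ℕ => 1 / ((n : ℂ) + x) - 1 / (((n + 1 : ℕ) : ℂ) + x) := by
    refine (summable_one_div_natCast_add_mul x (1 + x)).congr fun n => ?_
    have h1 := hne n
    have h2 := hne (n + 1)
    push_cast at h2 ⊢
    rw [← add_assoc]
    field_simp
    ring
  have := ((hs.hasSum_iff_tendsto_nat).2 hlim).add h1
  simp only [hterm]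
  simpa using this

/-- The partial fraction expansion of `1 / (1 - e⁻ᵘ)`. -/
lemma one_div_one_sub_exp_neg {u : ℝ} (hu : 0 < u) :
    1 / (1 - exp (-(u : ℂ))) = 1 / 2 + 1 / u +
      u * ∑' n : ℕ, 2 / ((2 * Real.pi * ((n : ℂ) + 1)) ^ 2 + (u : ℂ) ^ 2) := by
  have hpi : (Real.pi : ℂ) ≠ 0 := ofReal_ne_zero.2 Real.pi_ne_zero
  have hu' : (u : ℂ) ≠ 0 := ofReal_ne_zero.2 hu.ne'
  -- At this point 2πix = -u, so the exponential form of the cotangent involves only e⁻ᵘ.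
  set x : ℂ := I * (u / (2 * Real.pi)) with hx
  have hxc : x ∈ integerComplement := by
    rintro ⟨m, hm⟩
    have : (x).im = 0 := by rw [← hm]; simp
    have h2 : x = ((u / (2 * Real.pi) : ℝ) : ℂ) * I := by rw [hx]; push_cast; ring
    rw [h2, im_ofReal_mul, I_im, mul_one] at this
    have : 0 < u / (2 * Real.pi) := by positivity
    linarith
  have h := cot_series_rep' hxc
  rw [Complex.cot_pi_eq_exp_ratio] at h
  have he : 2 * Real.pi * I * x = -(u : ℂ) := by
    rw [hx]; field_simp; rw [I_sq]
  rw [he] at h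
  have hE : (1 : ℂ) - exp (-(u : ℂ)) ≠ 0 := by
    rw [sub_ne_zero]
    have : Real.exp (-u) < 1 := by rw [Real.exp_lt_one_iff]; linarith
    intro h'
    have h2 := congrArg Complex.re h'
    rw [← ofReal_neg, ← ofReal_exp, ofReal_re, one_re] at h2
    linarith
  have hterm : ∀ n : ℕ, 1 / (x - ((n : ℂ) + 1)) + 1 / (x + ((n : ℂ) + 1)) =
      (-I * u * 2 * Real.pi) * (2 / ((2 * Real.pi * ((n : ℂ) + 1)) ^ 2 + (u : ℂ) ^ 2)) := by
    intro n
    have h0 : ((2 * Real.pi * ((n : ℂ) + 1)) ^ 2 + (u : ℂ) ^ 2) ≠ 0 := by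
      have : 0 < (2 * Real.pi * ((n : ℝ) + 1)) ^ 2 + u ^ 2 := by positivity
      exact_mod_cast this.ne'
    have h1 : x - ((n : ℂ) + 1) ≠ 0 := fun h' => hxc ⟨n + 1, by push_cast; exact (sub_eq_zero.1 h').symm⟩
    have h2 : x + ((n : ℂ) + 1) ≠ 0 := fun h' =>
      hxc ⟨-(n + 1), by push_cast; linear_combination -h'⟩
    have h3 : (x - ((n : ℂ) + 1)) * (x + ((n : ℂ) + 1)) * (4 * Real.pi ^ 2) =
        -((2 * Real.pi * ((n : ℂ) + 1)) ^ 2 + (u : ℂ) ^ 2) := by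
      rw [hx]; field_simp; ring_nf; rw [I_sq]; ring
    rw [div_add_div _ _ h1 h2, ← mul_div_assoc, div_eq_div_iff (mul_ne_zero h1 h2) h0]
    have h4 : ((2 * Real.pi * ((n : ℂ) + 1)) ^ 2 + (u : ℂ) ^ 2) =
      -((x - ((n : ℂ) + 1)) * (x + ((n : ℂ) + 1)) * (4 * Real.pi ^ 2)) := by rw [h3]; ring
    rw [h4]
    have h5 : (u : ℂ) = -I * x * (2 * Real.pi) := by
      rw [hx]; field_simp; rw [I_sq]; ring
    rw [h5]
    linear_combination (-(x - ((n : ℂ) + 1)) * (x + ((n : ℂ) + 1)) * x * 8 * Real.pi ^ 2) * I_sq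
  simp only [hterm] at h
  rw [tsum_mul_left] at h
  set S := ∑' n : ℕ, 2 / ((2 * Real.pi * ((n : ℂ) + 1)) ^ 2 + (u : ℂ) ^ 2)
  set E := exp (-(u : ℂ))
  have h1 : 1 / x = -I * (2 * Real.pi / u) := by
    rw [hx]; field_simp; rw [I_sq]; ring
  have h2 : (E + 1) / (I * (1 - E)) = -I * (2 * (1 / (1 - E)) - 1) := by
    field_simp; rw [I_sq]; ring
  rw [h1, h2] at h
  have h3 : (-I * Real.pi * 2) * (1 / (1 - E) - (1 / 2 + 1 / u + u * S)) = 0 := by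
    linear_combination h
  rcases mul_eq_zero.1 h3 with h4 | h4
  · simp [hpi] at h4
  · exact sub_eq_zero.1 h4

/-! ### The Hermite kernel: integrability, cosine transform, entire integrals -/

/-- The kernel `-log (1 - e^{-2πx}) / π`, as a series. -/
noncomputable def hermiteKernel (x : ℝ) : ℝ :=
  ∑' n : ℕ, Real.exp (-(2 * Real.pi * (n + 1) * x)) / (Real.pi * (n + 1))

lemma integrableOn_exp_neg_mul_Ioi {b : ℝ} (hb : 0 < b) :
    IntegrableOn (fun x : ℝ => Real.exp (-(b * x))) (Ioi 0) := by
  simpa using exp_neg_integrableOn_Ioi 0 hb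

lemma integral_exp_neg_mul_Ioi' {b : ℝ} (hb : 0 < b) :
    ∫ x in Ioi (0 : ℝ), Real.exp (-(b * x)) = 1 / b := by
  have := Real.integral_rpow_mul_exp_neg_mul_Ioi one_pos hb
  simpa using this

lemma summable_hermite {b : ℝ} (hb : b < 2 * Real.pi) :
    Summable fun n : ℕ => 1 / (2 * Real.pi * (n + 1) - b) / (Real.pi * (n + 1)) := by
  have h1 := (summable_one_div_natCast_add_mul (1 - (b / (2 * Real.pi) : ℝ)) 1).norm.mul_left
    (1 / (2 * Real.pi ^ 2))
  refine h1.congr fun n => ?_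
  have hpi := Real.pi_pos
  have hb' : b / (2 * Real.pi) < 1 := by rw [div_lt_one (by positivity)]; exact hb
  have e1 : (((n : ℂ) + (1 - ((b / (2 * Real.pi) : ℝ) : ℂ))) * ((n : ℂ) + 1)) =
      (((n + (1 - b / (2 * Real.pi))) * (n + 1) : ℝ) : ℂ) := by push_cast; ring
  have hn : (0 : ℝ) ≤ n := Nat.cast_nonneg n
  have h0 : 0 < (n : ℝ) + (1 - b / (2 * Real.pi)) := by linarith
  rw [e1, norm_div, norm_one, norm_real, Real.norm_of_nonneg (by positivity)]
  have h2 : 2 * Real.pi * ((n : ℝ) + 1) - b = 2 * Real.pi * (n + (1 - b / (2 * Real.pi))) := by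
    field_simp; ring
  rw [h2]
  field_simp

lemma hasSum_integral_exp_mul_hermiteKernel {b : ℝ} (hb : b < 2 * Real.pi) :
    HasSum (fun n : ℕ => 1 / (2 * Real.pi * (n + 1) - b) / (Real.pi * (n + 1)))
      (∫ x in Ioi (0 : ℝ), Real.exp (b * x) * hermiteKernel x) := by
  have hpi := Real.pi_pos
  have hpos : ∀ n : ℕ, 0 < 2 * Real.pi * (n + 1) - b := fun n => by
    have : (0 : ℝ) ≤ n := Nat.cast_nonneg n
    nlinarith
  set F : ℕ → ℝ → ℝ := fun n x =>
    Real.exp (-((2 * Real.pi * (n + 1) - b) * x)) * (1 / (Real.pi * (n + 1))) with hF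
  have hFi : ∀ n, IntegrableOn (F n) (Ioi 0) := fun n =>
    (integrableOn_exp_neg_mul_Ioi (hpos n)).mul_const _
  have hFv : ∀ n, ∫ x in Ioi (0 : ℝ), F n x =
      1 / (2 * Real.pi * (n + 1) - b) / (Real.pi * (n + 1)) := fun n => by
    simp only [hF]
    rw [integral_mul_const, integral_exp_neg_mul_Ioi' (hpos n), mul_one_div]
  have hFn : ∀ n x, ‖F n x‖ = F n x := fun n x => Real.norm_of_nonneg (by positivity)
  have h := hasSum_integral_of_summable_integral_norm hFi (by
    simp only [hFn, hFv]; exact summable_hermite hb)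
  simp only [hFv] at h
  convert! h using 1
  refine integral_congr_ae (Eventually.of_forall fun x => ?_)
  simp only [hermiteKernel]
  rw [← tsum_mul_left]
  refine tsum_congr fun n => ?_
  simp only [hF]
  rw [← mul_div_assoc, ← Real.exp_add, mul_one_div]
  ring_nf

/-- The integral equals a convergent series of positive terms; being nonzero, it cannot be the
default value of a divergent integral. -/
lemma integrableOn_exp_mul_hermiteKernel {b : ℝ} (hb : b < 2 * Real.pi) :
    IntegrableOn (fun x => Real.exp (b * x) * hermiteKernel x) (Ioi 0) := by
  have h := hasSum_integral_exp_mul_hermiteKernel hb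
  have hpi := Real.pi_pos
  have hpos : ∀ n : ℕ, 0 < 2 * Real.pi * (n + 1) - b := fun n => by
    have : (0 : ℝ) ≤ n := Nat.cast_nonneg n
    nlinarith
  have h0 : 0 < ∫ x in Ioi (0 : ℝ), Real.exp (b * x) * hermiteKernel x := by
    refine lt_of_lt_of_le ?_ (h.summable.sum_le_tsum (Finset.range 1) (fun n _ => ?_) |>.trans
      h.tsum_eq.le)
    · have := hpos 0
      simp only [Finset.sum_range_one]
      positivity
    · have := hpos n
      positivity
  by_contra hcon
  rw [integral_undef hcon] at h0
  exact lt_irrefl _ h0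

lemma integrableOn_hermiteKernel : IntegrableOn hermiteKernel (Ioi 0) := by
  simpa using integrableOn_exp_mul_hermiteKernel (b := 0) (by positivity)

lemma hermiteKernel_nonneg (x : ℝ) : 0 ≤ hermiteKernel x := tsum_nonneg fun n => by positivity

/-- The cosine transform of the kernel. -/
lemma integral_hermiteKernel_mul_cos (u : ℝ) :
    ∫ x in Ioi (0 : ℝ), (hermiteKernel x : ℂ) * cos (u * x) =
      ∑' n : ℕ, 2 / ((2 * Real.pi * ((n : ℂ) + 1)) ^ 2 + (u : ℂ) ^ 2) := by
  have hpi := Real.pi_pos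
  have hpos : ∀ n : ℕ, 0 < 2 * Real.pi * ((n : ℝ) + 1) := fun n => by positivity
  set F : ℕ → ℝ → ℂ := fun n x => (1 / (Real.pi * ((n : ℂ) + 1)) / 2) *
    (exp (-((((2 * Real.pi * ((n : ℝ) + 1) : ℝ) : ℂ) - u * I) * x)) +
     exp (-((((2 * Real.pi * ((n : ℝ) + 1) : ℝ) : ℂ) + u * I) * x))) with hF
  have hre1 : ∀ n : ℕ, 0 < (((2 * Real.pi * ((n : ℝ) + 1) : ℝ) : ℂ) - u * I).re := fun n => by
    simpa using hpos n
  have hre2 : ∀ n : ℕ, 0 < (((2 * Real.pi * ((n : ℝ) + 1) : ℝ) : ℂ) + u * I).re := fun n => by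
    simpa using hpos n
  have hi : ∀ z : ℂ, 0 < z.re → IntegrableOn (fun x : ℝ => exp (-(z * x))) (Ioi 0) := fun z hz => by
    simpa using integrableOn_cpow_mul_exp_neg (s := 1) (by simp) hz
  have hv : ∀ z : ℂ, 0 < z.re → ∫ x in Ioi (0 : ℝ), exp (-(z * x)) = z⁻¹ := fun z hz => by
    simpa [cpow_neg_one] using integral_cpow_mul_exp_neg (s := 1) (by simp) hz
  have hFi : ∀ n, IntegrableOn (F n) (Ioi 0) := fun n =>
    ((hi _ (hre1 n)).add (hi _ (hre2 n))).const_mul _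
  have hFv : ∀ n, ∫ x in Ioi (0 : ℝ), F n x =
      2 / ((2 * Real.pi * ((n : ℂ) + 1)) ^ 2 + (u : ℂ) ^ 2) := by
    intro n
    simp only [hF]
    rw [integral_const_mul, integral_add (hi _ (hre1 n)) (hi _ (hre2 n)), hv _ (hre1 n),
      hv _ (hre2 n)]
    have h1 := ne_zero_of_re_pos (hre1 n)
    have h2 := ne_zero_of_re_pos (hre2 n)
    have h3 : (2 * Real.pi * ((n : ℂ) + 1)) ^ 2 + (u : ℂ) ^ 2 =
        (((2 * Real.pi * ((n : ℝ) + 1) : ℝ) : ℂ) - u * I) *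
        (((2 * Real.pi * ((n : ℝ) + 1) : ℝ) : ℂ) + u * I) := by
      push_cast; linear_combination (u : ℂ) ^ 2 * I_sq
    have h4 : (Real.pi : ℂ) ≠ 0 := ofReal_ne_zero.2 hpi.ne'
    have h5 : (n : ℂ) + 1 ≠ 0 := Nat.cast_add_one_ne_zero n
    have h6 : (((2 * Real.pi * ((n : ℝ) + 1) : ℝ) : ℂ) - u * I) +
        (((2 * Real.pi * ((n : ℝ) + 1) : ℝ) : ℂ) + u * I) = 4 * (Real.pi * ((n : ℂ) + 1)) := by
      push_cast; ring
    rw [h3]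
    generalize (((2 * Real.pi * ((n : ℝ) + 1) : ℝ) : ℂ) - u * I) = P at *
    generalize (((2 * Real.pi * ((n : ℝ) + 1) : ℝ) : ℂ) + u * I) = Q at *
    field_simp
    linear_combination h6
  have hbound : ∀ n x, 0 < x → ‖F n x‖ ≤
      Real.exp (-(2 * Real.pi * (n + 1) * x)) / (Real.pi * (n + 1)) := by
    intro n x hx
    have e1 : ‖exp (-((((2 * Real.pi * ((n : ℝ) + 1) : ℝ) : ℂ) - u * I) * x))‖ =
      Real.exp (-(2 * Real.pi * (n + 1) * x)) := by rw [norm_exp]; simp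
    have e2 : ‖exp (-((((2 * Real.pi * ((n : ℝ) + 1) : ℝ) : ℂ) + u * I) * x))‖ =
      Real.exp (-(2 * Real.pi * (n + 1) * x)) := by rw [norm_exp]; simp
    have e3 : ‖(1 / (Real.pi * ((n : ℂ) + 1)) / 2)‖ = 1 / (Real.pi * (n + 1)) / 2 := by
      have : (1 / (Real.pi * ((n : ℂ) + 1)) / 2) = ((1 / (Real.pi * (n + 1)) / 2 : ℝ) : ℂ) := by
        push_cast; ring
      rw [this, norm_real, Real.norm_of_nonneg (by positivity)]
    simp only [hF]
    rw [norm_mul, e3]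
    refine (mul_le_mul_of_nonneg_left (norm_add_le _ _) (by positivity)).trans ?_
    rw [e1, e2]
    apply le_of_eq
    ring
  have hsum : Summable fun n => ∫ x in Ioi (0 : ℝ), ‖F n x‖ := by
    refine Summable.of_nonneg_of_le (fun n => integral_nonneg fun x => norm_nonneg _) (fun n => ?_)
      (summable_hermite (b := 0) (by positivity))
    rw [sub_zero, ← integral_exp_neg_mul_Ioi' (hpos n), ← integral_div]
    exact setIntegral_mono_on (hFi n).norm ((integrableOn_exp_neg_mul_Ioi (hpos n)).div_const _)
      measurableSet_Ioi fun x hx => hbound n x hx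
  have h := hasSum_integral_of_summable_integral_norm hFi hsum
  simp only [hFv] at h
  rw [h.tsum_eq]
  refine setIntegral_congr_fun measurableSet_Ioi fun x _ => ?_
  simp only [hermiteKernel]
  rw [ofReal_tsum, ← tsum_mul_right]
  refine tsum_congr fun n => ?_
  have h4 : (Real.pi : ℂ) ≠ 0 := ofReal_ne_zero.2 hpi.ne'
  have h5 : (n : ℂ) + 1 ≠ 0 := Nat.cast_add_one_ne_zero n
  have e1 : -((((2 * Real.pi * ((n : ℝ) + 1) : ℝ) : ℂ) - u * I) * x) =
      ((-(2 * Real.pi * (n + 1) * x) : ℝ) : ℂ) + (u * x) * I := by push_cast; ring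
  have e2 : -((((2 * Real.pi * ((n : ℝ) + 1) : ℝ) : ℂ) + u * I) * x) =
      ((-(2 * Real.pi * (n + 1) * x) : ℝ) : ℂ) + (-(u * x)) * I := by push_cast; ring
  simp only [hF]
  rw [e1, e2, exp_add, exp_add, cos]
  push_cast
  field_simp

/-- The slope ε is arbitrary so that any power of a ± ix can be bounded by an exponential of rate 1,
well below the decay rate 2π of the kernel. -/
lemma abs_log_le {y r ε : ℝ} (hr : 0 < r) (hy : r ≤ y) (hε : 0 < ε) :
    |Real.log y| ≤ ε * y + (|Real.log ε| + |Real.log r|) := by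
  have hy0 : 0 < y := hr.trans_le hy
  have h1 : Real.log (ε * y) ≤ ε * y - 1 := Real.log_le_sub_one_of_pos (by positivity)
  rw [Real.log_mul hε.ne' hy0.ne'] at h1
  have h2 := Real.log_le_log hr hy
  have h3 := neg_abs_le (Real.log ε)
  have h4 := neg_abs_le (Real.log r)
  have h5 := abs_nonneg (Real.log r)
  have h6 := abs_nonneg (Real.log ε)
  have h7 : 0 < ε * y := by positivity
  rw [abs_le]; constructor <;> linarith

lemma norm_log_le (z : ℂ) : ‖log z‖ ≤ |Real.log ‖z‖| + Real.pi := by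
  refine (norm_le_abs_re_add_abs_im _).trans ?_
  rw [log_re, log_im]
  gcongr
  exact abs_arg_le_pi z

lemma add_ofReal_mul_I_re (a : ℂ) (x : ℝ) : (a + x * I).re = a.re := by simp

lemma continuous_log_add_ofReal_mul_I {a : ℂ} (ha : 0 < a.re) (σ : ℝ) :
    Continuous fun x : ℝ => log (a + (σ * x : ℝ) * I) := by
  refine Continuous.clog (by fun_prop) fun x => Or.inl ?_
  rw [add_ofReal_mul_I_re]; exact ha

lemma aestronglyMeasurable_hermiteKernel :
    AEStronglyMeasurable (fun x : ℝ => (hermiteKernel x : ℂ)) (volume.restrict (Ioi 0)) :=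
  continuous_ofReal.comp_aestronglyMeasurable integrableOn_hermiteKernel.1

/-- Taking slope 1/R in `abs_log_le` with R = ‖z₀‖ + 1 bounds the exponent by C + x, so
integrability against the kernel reduces to rate b = 1 < 2π. This holds for every z₀, which makes
the parameter integral entire. -/
lemma integrable_norm_hermiteKernel_mul_exp {a : ℂ} (ha : 0 < a.re) {σ : ℝ} (hσ : |σ| = 1)
    (z₀ : ℂ) :
    Integrable (fun x : ℝ => ‖(hermiteKernel x : ℂ)‖ *
      Real.exp ((z₀ * log (a + (σ * x : ℝ) * I)).re + 1 * ‖log (a + (σ * x : ℝ) * I)‖))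
      (volume.restrict (Ioi 0)) := by
  have hcont := continuous_log_add_ofReal_mul_I ha σ
  set R : ℝ := ‖z₀‖ + 1 with hR
  have hR0 : 0 < R := by positivity
  set C : ℝ := R * (|Real.log (1 / R)| + |Real.log a.re| + Real.pi) + ‖a‖ with hC
  have hb : ∀ x ∈ Ioi (0 : ℝ), (z₀ * log (a + (σ * x : ℝ) * I)).re +
      1 * ‖log (a + (σ * x : ℝ) * I)‖ ≤ C + 1 * x := by
    intro x hx
    have h1 : (z₀ * log (a + (σ * x : ℝ) * I)).re ≤ ‖z₀‖ * ‖log (a + (σ * x : ℝ) * I)‖ :=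
      (re_le_norm _).trans (norm_mul _ _).le
    have h2 := norm_log_le (a + (σ * x : ℝ) * I)
    have h3 := abs_log_le (y := ‖a + (σ * x : ℝ) * I‖) ha
      (by rw [← add_ofReal_mul_I_re a (σ * x)]; exact re_le_norm _) (ε := 1 / R) (by positivity)
    have h4 : ‖a + (σ * x : ℝ) * I‖ ≤ ‖a‖ + x := by
      refine (norm_add_le _ _).trans ?_
      rw [norm_mul, norm_I, norm_real, Real.norm_eq_abs, abs_mul, hσ, abs_of_pos hx]; simp
    have h5 : R * ‖log (a + (σ * x : ℝ) * I)‖ ≤ R * (1 / R * (‖a‖ + x) +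
        (|Real.log (1 / R)| + |Real.log a.re|) + Real.pi) := by
      gcongr
      refine h2.trans (by gcongr; refine h3.trans (by gcongr))
    have h6 : R * (1 / R * (‖a‖ + x) + (|Real.log (1 / R)| + |Real.log a.re|) + Real.pi) =
        C + 1 * x := by rw [hC]; field_simp; ring
    rw [h6] at h5
    have h7 : R * ‖log (a + (σ * x : ℝ) * I)‖ = ‖z₀‖ * ‖log (a + (σ * x : ℝ) * I)‖ +
      1 * ‖log (a + (σ * x : ℝ) * I)‖ := by rw [hR]; ring
    linarith
  have hint := (integrableOn_exp_mul_hermiteKernel (b := 1)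
    (by have := Real.pi_gt_three; linarith)).const_mul (Real.exp C)
  refine hint.mono' ?_ ?_
  · refine aestronglyMeasurable_hermiteKernel.norm.mul (Continuous.aestronglyMeasurable ?_)
    exact Real.continuous_exp.comp ((continuous_re.comp (continuous_const.mul hcont)).add
      (continuous_const.mul hcont.norm))
  · filter_upwards [ae_restrict_mem measurableSet_Ioi] with x hx
    have hk := hermiteKernel_nonneg x
    rw [norm_mul, norm_norm, norm_real, Real.norm_of_nonneg hk,
      Real.norm_of_nonneg (Real.exp_pos _).le]
    calc _ ≤ hermiteKernel x * Real.exp (C + 1 * x) := by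
          exact mul_le_mul_of_nonneg_left (Real.exp_le_exp.2 (hb x hx)) hk
      _ = _ := by rw [Real.exp_add]; ring

lemma differentiable_integral_hermiteKernel_mul_cpow {a : ℂ} (ha : 0 < a.re) {σ : ℝ}
    (hσ : |σ| = 1) :
    Differentiable ℂ fun z => ∫ x in Ioi (0 : ℝ),
      (hermiteKernel x : ℂ) * exp (z * log (a + (σ * x : ℝ) * I)) := fun z₀ =>
  differentiableAt_integral_mul_exp aestronglyMeasurable_hermiteKernel
    (continuous_log_add_ofReal_mul_I ha σ).aestronglyMeasurable one_pos
    (integrable_norm_hermiteKernel_mul_exp ha hσ z₀)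

lemma integrableOn_hermiteKernel_mul_cpow {a : ℂ} (ha : 0 < a.re) {σ : ℝ} (hσ : |σ| = 1) (z : ℂ) :
    IntegrableOn (fun x : ℝ => (hermiteKernel x : ℂ) * exp (z * log (a + (σ * x : ℝ) * I)))
      (Ioi 0) := by
  refine (integrable_norm_hermiteKernel_mul_exp ha hσ z).mono'
    (aestronglyMeasurable_hermiteKernel.mul (Continuous.aestronglyMeasurable
      (continuous_exp.comp (continuous_const.mul (continuous_log_add_ofReal_mul_I ha σ)))))
    (Eventually.of_forall fun x => ?_)
  rw [norm_mul, norm_exp]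
  gcongr
  linarith [norm_nonneg (log (a + (σ * x : ℝ) * I))]

/-! ### Hermite's formula and the Hurwitz zeta function -/

/-- `∫ κ(x) (a + iσx) ^ (-s - 1)` over the half-line, `κ` the Hermite kernel. -/
noncomputable def hermiteIntegral (σ : ℝ) (s a : ℂ) : ℂ :=
  ∫ x in Ioi (0 : ℝ), (hermiteKernel x : ℂ) * exp ((-s - 1) * log (a + (σ * x : ℝ) * I))

lemma differentiable_hermiteIntegral {a : ℂ} (ha : 0 < a.re) {σ : ℝ} (hσ : |σ| = 1) :
    Differentiable ℂ fun s => hermiteIntegral σ s a :=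
  (differentiable_integral_hermiteKernel_mul_cpow ha hσ).comp
    (f := fun s : ℂ => -s - 1) (by fun_prop)

/-- The cosine is the half sum of two exponentials, so this is a pair of Laplace transforms at a ±
ix. The powers are left as exp of a logarithm to match `hermiteIntegral`. -/
lemma laplace_cos {s a : ℂ} (hs : 0 < s.re) (ha : 0 < a.re) (x : ℝ) :
    ∫ u in Ioi (0 : ℝ), (u : ℂ) ^ s * exp (-(a * u)) * cos (u * x) = Gamma (s + 1) / 2 *
      (exp ((-s - 1) * log (a + (1 * x : ℝ) * I)) + exp ((-s - 1) * log (a + (-1 * x : ℝ) * I))) := by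
  have hre : ∀ y : ℝ, 0 < (a + y * I).re := fun y => by rw [add_ofReal_mul_I_re]; exact ha
  have hs1 : 0 < (s + 1).re := by simp; linarith
  have hi := fun y : ℝ => integrableOn_cpow_mul_exp_neg hs1 (hre y)
  have hv := fun y : ℝ => integral_cpow_mul_exp_neg hs1 (hre y)
  have hp : ∀ y : ℝ, (a + y * I) ^ (-(s + 1)) = exp ((-s - 1) * log (a + y * I)) := fun y => by
    rw [cpow_def_of_ne_zero (ne_zero_of_re_pos (hre y))]; ring_nf
  have h : ∀ u : ℝ, (u : ℂ) ^ s * exp (-(a * u)) * cos (u * x) =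
      1 / 2 * ((u : ℂ) ^ (s + 1 - 1) * exp (-((a + (1 * x : ℝ) * I) * u)) +
        (u : ℂ) ^ (s + 1 - 1) * exp (-((a + (-1 * x : ℝ) * I) * u))) := by
    intro u
    have e1 : -((a + (1 * x : ℝ) * I) * u) = -(a * u) + -(u * x) * I := by push_cast; ring
    have e2 : -((a + (-1 * x : ℝ) * I) * u) = -(a * u) + (u * x) * I := by push_cast; ring
    rw [e1, e2, exp_add, exp_add, cos, add_sub_cancel_right]
    ring
  simp only [h]
  rw [integral_const_mul, integral_add (hi _) (hi _), hv, hv, hp, hp]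
  ring

lemma integrable_prod_hermite {s a : ℂ} (hs : 0 < s.re) (ha : 0 < a.re) :
    Integrable (fun p : ℝ × ℝ => (((p.1 : ℂ) ^ s * exp (-(a * p.1))) * (hermiteKernel p.2 : ℂ)) *
      cos (p.1 * p.2)) ((volume.restrict (Ioi 0)).prod (volume.restrict (Ioi 0))) := by
  have h1 : IntegrableOn (fun u : ℝ => (u : ℂ) ^ s * exp (-(a * u))) (Ioi 0) := by
    simpa using integrableOn_cpow_mul_exp_neg (s := s + 1) (by simp; linarith) ha
  have h2 : IntegrableOn (fun x => (hermiteKernel x : ℂ)) (Ioi 0) := integrableOn_hermiteKernel.ofReal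
  refine (Integrable.mul_prod h1 h2).mul_bdd (c := 1) ?_ (Eventually.of_forall fun p => ?_)
  · exact Continuous.aestronglyMeasurable (by fun_prop)
  · have : cos ((p.1 : ℂ) * p.2) = ((Real.cos (p.1 * p.2) : ℝ) : ℂ) := by push_cast; rfl
    rw [this, norm_real]
    exact Real.abs_cos_le_one _

/-- The series is the cosine transform of the kernel; Fubini lets the u-integral be done first,
through `laplace_cos`. -/
lemma integral_hermite_swap {s a : ℂ} (hs : 0 < s.re) (ha : 0 < a.re) :
    IntegrableOn (fun u : ℝ => (u : ℂ) ^ s * exp (-(a * u)) *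
      ∑' n : ℕ, 2 / ((2 * Real.pi * ((n : ℂ) + 1)) ^ 2 + (u : ℂ) ^ 2)) (Ioi 0) ∧
    ∫ u in Ioi (0 : ℝ), (u : ℂ) ^ s * exp (-(a * u)) *
      ∑' n : ℕ, 2 / ((2 * Real.pi * ((n : ℂ) + 1)) ^ 2 + (u : ℂ) ^ 2) =
      Gamma (s + 1) / 2 * (hermiteIntegral 1 s a + hermiteIntegral (-1) s a) := by
  have hF := integrable_prod_hermite hs ha
  have h1 : ∀ u : ℝ, ∫ x in Ioi (0 : ℝ), (((u : ℂ) ^ s * exp (-(a * u))) * (hermiteKernel x : ℂ)) *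
      cos (u * x) = (u : ℂ) ^ s * exp (-(a * u)) *
      ∑' n : ℕ, 2 / ((2 * Real.pi * ((n : ℂ) + 1)) ^ 2 + (u : ℂ) ^ 2) := by
    intro u
    rw [← integral_hermiteKernel_mul_cos, ← integral_const_mul]
    simp only [mul_assoc]
  have h2 : ∀ x : ℝ, ∫ u in Ioi (0 : ℝ), (((u : ℂ) ^ s * exp (-(a * u))) * (hermiteKernel x : ℂ)) *
      cos (u * x) = Gamma (s + 1) / 2 *
      ((hermiteKernel x : ℂ) * exp ((-s - 1) * log (a + (1 * x : ℝ) * I)) +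
       (hermiteKernel x : ℂ) * exp ((-s - 1) * log (a + (-1 * x : ℝ) * I))) := by
    intro x
    rw [← mul_add, mul_left_comm, ← laplace_cos hs ha, ← integral_const_mul]
    congr 1; ext u; ring
  refine ⟨(by simpa only [h1] using hF.integral_prod_left : Integrable _ _), ?_⟩
  simp only [← h1]
  rw [integral_integral_swap hF]
  simp only [h2]
  rw [integral_const_mul, integral_add
    (integrableOn_hermiteKernel_mul_cpow ha (by simp) _)
    (integrableOn_hermiteKernel_mul_cpow ha (by simp) _)]
  rfl

/-- The function `(s - 1) ζ(s, a)`, as an entire function of `s` (Hermite's formula). -/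
noncomputable def hurwitzEntire (s a : ℂ) : ℂ :=
  a ^ (1 - s) + (s - 1) * (a ^ (-s) / 2 +
    s / 2 * (hermiteIntegral 1 s a + hermiteIntegral (-1) s a))

lemma differentiable_hurwitzEntire {a : ℂ} (ha : 0 < a.re) :
    Differentiable ℂ fun s => hurwitzEntire s a := by
  have h0 := ne_zero_of_re_pos ha
  have h1 := differentiable_hermiteIntegral ha (σ := 1) (by simp)
  have h2 := differentiable_hermiteIntegral ha (σ := -1) (by simp)
  have h3 : Differentiable ℂ fun s : ℂ => a ^ (1 - s) := fun s =>
    DifferentiableAt.const_cpow (by fun_prop) (Or.inl h0)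
  have h4 : Differentiable ℂ fun s : ℂ => a ^ (-s) := fun s =>
    DifferentiableAt.const_cpow (by fun_prop) (Or.inl h0)
  unfold hurwitzEntire
  fun_prop

lemma natCast_add_re_pos {a : ℂ} (ha : 0 < a.re) (n : ℕ) : 0 < ((n : ℂ) + a).re := by
  have : (0 : ℝ) ≤ n := Nat.cast_nonneg n
  simp; linarith

lemma summable_natCast_add_rpow {r p : ℝ} (hr : 0 < r) (hp : p < -1) :
    Summable fun n : ℕ => ((n : ℝ) + r) ^ p := by
  have h := Real.summable_nat_rpow.2 hp
  rw [← summable_nat_add_iff 1] at h ⊢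
  have hb : ∀ n : ℕ, (((n + 1 : ℕ) : ℝ) + r) ^ p ≤ (((n + 1 : ℕ) : ℝ)) ^ p := fun n =>
    Real.rpow_le_rpow_of_nonpos (by positivity) (by linarith) (by linarith)
  exact Summable.of_nonneg_of_le (fun n => by positivity) hb h

/-- Each (n + a)^(-s) Γ(s) is a Laplace integral, and the sum over n is geometric with ratio e⁻ᵘ.
The three parts 1/2, 1/u and u times a series of 1/(1 - e⁻ᵘ) yield the three terms of Hermite's
formula. -/
lemma hasSum_hurwitz {s a : ℂ} (hs : 1 < s.re) (ha : 0 < a.re) :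
    HasSum (fun n : ℕ => ((n : ℂ) + a) ^ (-s)) (hurwitzEntire s a / (s - 1)) := by
  have hs0 : 0 < s.re := by linarith
  have hre := natCast_add_re_pos ha
  have hG := Gamma_ne_zero_of_re_pos hs0
  have hs1 : s - 1 ≠ 0 := by
    intro h; rw [sub_eq_zero] at h; rw [h] at hs; simp at hs
  set F : ℕ → ℝ → ℂ := fun n u => (u : ℂ) ^ (s - 1) * exp (-(((n : ℂ) + a) * u)) with hF
  have hsum : Summable fun n => ∫ u in Ioi (0 : ℝ), ‖F n u‖ := by
    have h := (summable_natCast_add_rpow ha (p := -s.re) (by linarith)).mul_right (Real.Gamma s.re)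
    refine h.congr fun n => ?_
    simp only [hF]
    rw [integral_norm_cpow_mul_exp_neg hs0 (hre n), one_div, Real.inv_rpow (hre n).le,
      ← Real.rpow_neg (hre n).le]
    simp
  have h := hasSum_integral_of_summable_integral_norm
    (fun n => integrableOn_cpow_mul_exp_neg hs0 (hre n)) hsum
  simp only [integral_cpow_mul_exp_neg hs0 (hre _)] at h
  have h' := h.mul_right (Gamma s)⁻¹
  simp only [mul_inv_cancel_right₀ hG] at h'
  convert! h' using 1
  have hgeom : ∀ u ∈ Ioi (0 : ℝ), ∑' n, F n u = 1 / 2 * ((u : ℂ) ^ (s - 1) * exp (-(a * u))) +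
      (u : ℂ) ^ ((s - 1) - 1) * exp (-(a * u)) + (u : ℂ) ^ s * exp (-(a * u)) *
      ∑' n : ℕ, 2 / ((2 * Real.pi * ((n : ℂ) + 1)) ^ 2 + (u : ℂ) ^ 2) := by
    intro u hu
    have hu' : (0 : ℝ) < u := hu
    have hu0 : (u : ℂ) ≠ 0 := ofReal_ne_zero.2 hu'.ne'
    have hlt : ‖exp (-(u : ℂ))‖ < 1 := by rw [norm_exp]; simpa using hu'
    have e : ∀ n, F n u = (u : ℂ) ^ (s - 1) * exp (-(a * u)) * exp (-(u : ℂ)) ^ n := by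
      intro n
      simp only [hF]
      rw [← exp_nat_mul, mul_assoc, ← exp_add]; ring_nf
    simp only [e]
    rw [tsum_mul_left, tsum_geometric_of_norm_lt_one hlt, ← one_div, one_div_one_sub_exp_neg hu',
      cpow_sub (s - 1) 1 hu0, cpow_sub s 1 hu0, cpow_one]
    field_simp
  have hi1 : IntegrableOn (fun u : ℝ => 1 / 2 * ((u : ℂ) ^ (s - 1) * exp (-(a * u)))) (Ioi 0) :=
    (integrableOn_cpow_mul_exp_neg hs0 ha).const_mul _
  have hi2 : IntegrableOn (fun u : ℝ => (u : ℂ) ^ ((s - 1) - 1) * exp (-(a * u))) (Ioi 0) :=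
    integrableOn_cpow_mul_exp_neg (by simpa using hs) ha
  obtain ⟨hi3, hv3⟩ := integral_hermite_swap hs0 ha
  have hi12 : IntegrableOn (fun u : ℝ => 1 / 2 * ((u : ℂ) ^ (s - 1) * exp (-(a * u))) +
      (u : ℂ) ^ ((s - 1) - 1) * exp (-(a * u))) (Ioi 0) := hi1.add hi2
  rw [setIntegral_congr_fun measurableSet_Ioi hgeom, integral_add hi12 hi3, integral_add hi1 hi2, integral_const_mul, integral_cpow_mul_exp_neg hs0 ha,
    integral_cpow_mul_exp_neg (by simpa using hs) ha, hv3,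
    Gamma_add_one s (by rintro rfl; simp at hs0)]
  have hGs : Gamma s = (s - 1) * Gamma (s - 1) := by
    have := Gamma_add_one (s - 1) hs1
    rwa [sub_add_cancel] at this
  have hG1 : Gamma (s - 1) ≠ 0 := fun h0 => hG (by rw [hGs, h0, mul_zero])
  rw [hGs, hurwitzEntire, show -(s - 1) = 1 - s by ring]
  field_simp
  ring

lemma isHurwitzContinuation_hurwitzEntire {a : ℂ} (ha : 0 < a.re) :
    IsHurwitzContinuation a fun s => hurwitzEntire s a / (s - 1) := by
  refine ⟨?_, fun s hs => hasSum_hurwitz hs ha⟩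
  exact (differentiable_hurwitzEntire ha).differentiableOn.div (by fun_prop)
    fun s hs => sub_ne_zero.2 hs

/-- The plane minus a point is connected, so the chosen continuation must be Hermite's. -/
lemma hurwitzZ_eq {s a : ℂ} (ha : 0 < a.re) (hs : s ≠ 1) :
    hurwitzZ s a = hurwitzEntire s a / (s - 1) := by
  have hex : ∃ f, IsHurwitzContinuation a f := ⟨_, isHurwitzContinuation_hurwitzEntire ha⟩
  have hspec := Classical.choose_spec hex
  have h0 := isHurwitzContinuation_hurwitzEntire ha
  rw [hurwitzZ, dif_pos hex]
  have hsub : {z : ℂ | 1 < z.re} ⊆ {1}ᶜ := by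
    rintro z hz rfl; simp at hz
  refine eqOn_of_eqOn_open isOpen_compl_singleton
    (isConnected_compl_singleton_of_one_lt_rank (by simp) 1).isPreconnected
    hspec.1 h0.1 (isOpen_re_gt 1) hsub ⟨2, by simp⟩ (fun z hz => ?_) hs
  exact (hspec.2 z hz).unique (h0.2 z hz)

/-! ### The secant and its partial fractions -/

/-- The four second arguments of the Hurwitz zeta function. -/
noncomputable def hurwitzArg (t : ℂ) : Fin 4 → ℂ :=
  ![(Real.pi - t) / (4 * Real.pi), (t + Real.pi) / (4 * Real.pi), 3 / 4 - t / (4 * Real.pi),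
    1 / 4 * (t / Real.pi + 3)]

/-- Indexed like `hurwitzArg`: these are the signs of the part of the secant expansion odd in ξ, and
`signCosh` holds those of the even part. -/
def signSinh : Fin 4 → ℂ := ![1, -1, -1, 1]

def signCosh : Fin 4 → ℂ := ![1, 1, -1, -1]

/-- `sinh x / (cos t + cosh 2x)` -/
noncomputable def sinhQuot (t : ℂ) (x : ℝ) : ℂ := sinh x / (cos t + cosh (2 * x))

/-- `cosh x / (cos t + cosh 2x)` -/
noncomputable def coshQuot (t : ℂ) (x : ℝ) : ℂ := cosh x / (cos t + cosh (2 * x))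

lemma hurwitzArg_re_pos {t : ℂ} (h1 : -Real.pi < t.re) (h2 : t.re < Real.pi) (i : Fin 4) :
    0 < (hurwitzArg t i).re := by
  have hpi := Real.pi_pos
  have e : ∀ z : ℂ, (z / (4 * Real.pi)).re = z.re / (4 * Real.pi) := fun z => by
    rw [show (4 * Real.pi : ℂ) = ((4 * Real.pi : ℝ) : ℂ) by push_cast; rfl, div_ofReal_re]
  have e0 : (Real.pi : ℂ) ≠ 0 := ofReal_ne_zero.2 hpi.ne'
  have e3 : (3 / 4 - t / (4 * Real.pi)) = (3 * Real.pi - t) / (4 * Real.pi) := by field_simp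
  have e4 : (1 / 4 * (t / Real.pi + 3)) = (t + 3 * Real.pi) / (4 * Real.pi) := by field_simp
  have e5 : (3 * Real.pi : ℂ) = ((3 * Real.pi : ℝ) : ℂ) := by push_cast; rfl
  fin_cases i <;> simp only [hurwitzArg, Fin.zero_eta, Fin.mk_one, Fin.reduceFinMk,
    Matrix.cons_val, e3, e4, e, e5, sub_re, add_re, ofReal_re]
  all_goals exact div_pos (by linarith) (by positivity)

lemma cos_ne_zero_of_abs_re_lt {z : ℂ} (h1 : -(Real.pi / 2) < z.re) (h2 : z.re < Real.pi / 2) :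
    cos z ≠ 0 := by
  rw [Ne, cos_eq_zero_iff]
  rintro ⟨k, rfl⟩
  have hpi := Real.pi_pos
  have e : ((2 * (k : ℂ) + 1) * Real.pi / 2).re = (2 * (k : ℝ) + 1) * Real.pi / 2 := by
    rw [show (2 * (k : ℂ) + 1) * Real.pi / 2 = (((2 * (k : ℝ) + 1) * Real.pi / 2 : ℝ) : ℂ) by
      push_cast; rfl, ofReal_re]
  rw [e] at h1 h2
  have h3 : (-1 : ℝ) < 2 * k + 1 := by nlinarith
  have h4 : 2 * (k : ℝ) + 1 < 1 := by nlinarith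
  have h5 : (-1 : ℤ) < 2 * k + 1 := by exact_mod_cast h3
  have h6 : 2 * k + 1 < (1 : ℤ) := by exact_mod_cast h4
  omega

lemma sin_half_ne_zero {t : ℂ} (h1 : -Real.pi < t.re) (h2 : t.re < Real.pi) (h0 : t ≠ 0) :
    sin (t / 2) ≠ 0 := by
  rw [Ne, sin_eq_zero_iff]
  rintro ⟨k, hk⟩
  have hpi := Real.pi_pos
  have ht : t = ((2 * k * Real.pi : ℝ) : ℂ) := by push_cast; linear_combination 2 * hk
  rw [ht, ofReal_re] at h1 h2
  have h3 : (-1 : ℝ) < 2 * k := by nlinarith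
  have h4 : 2 * (k : ℝ) < 1 := by nlinarith
  have h5 : (-1 : ℤ) < 2 * k := by exact_mod_cast h3
  have h6 : 2 * k < (1 : ℤ) := by exact_mod_cast h4
  have : k = 0 := by omega
  apply h0
  rw [ht, this]; simp

lemma half_re (t : ℂ) : (t / 2).re = t.re / 2 := by
  rw [show (2 : ℂ) = ((2 : ℝ) : ℂ) by norm_cast, div_ofReal_re]

lemma cos_half_add_ne_zero {t : ℂ} (h1 : -Real.pi < t.re) (h2 : t.re < Real.pi) (y : ℝ) :
    cos (t / 2 + y * I) ≠ 0 := by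
  refine cos_ne_zero_of_abs_re_lt ?_ ?_ <;> rw [add_re, half_re] <;> simp <;> linarith

lemma cos_half_ne_zero {t : ℂ} (h1 : -Real.pi < t.re) (h2 : t.re < Real.pi) :
    cos (t / 2) ≠ 0 := by
  simpa using cos_half_add_ne_zero h1 h2 0

lemma cos_half_add (t : ℂ) (x : ℝ) :
    cos (t / 2 + x * I) = cos (t / 2) * cosh x - sin (t / 2) * sinh x * I := by
  rw [cos_add, cos_mul_I, sin_mul_I]; ring

lemma cos_half_add_neg (t : ℂ) (x : ℝ) :
    cos (t / 2 + (-x : ℝ) * I) = cos (t / 2) * cosh x + sin (t / 2) * sinh x * I := by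
  rw [cos_add, cos_mul_I, sin_mul_I]; push_cast; rw [cosh_neg, sinh_neg]; ring

/-- Product formula for the angles t/2 ± ix: the denominator of both quotients is the common
denominator of two secants. -/
lemma cos_add_cosh_eq (t : ℂ) (x : ℝ) :
    cos t + cosh (2 * x) = 2 * cos (t / 2 + x * I) * cos (t / 2 + (-x : ℝ) * I) := by
  have e1 : cos t = 2 * cos (t / 2) ^ 2 - 1 := by rw [← cos_two_mul]; ring_nf
  rw [cos_half_add_neg, cos_half_add, e1, cosh_two_mul]
  linear_combination (2 * sin (t / 2) ^ 2 * sinh (x : ℂ) ^ 2) * I_sq +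
    (1 - 2 * cos (t / 2) ^ 2) * cosh_sq (x : ℂ) - 2 * sinh (x : ℂ) ^ 2 * sin_sq_add_cos_sq (t / 2)

lemma cos_add_cosh_ne_zero {t : ℂ} (h1 : -Real.pi < t.re) (h2 : t.re < Real.pi) (x : ℝ) :
    cos t + cosh (2 * x) ≠ 0 := by
  rw [cos_add_cosh_eq]
  exact mul_ne_zero (mul_ne_zero two_ne_zero (cos_half_add_ne_zero h1 h2 x))
    (cos_half_add_ne_zero h1 h2 (-x))

lemma inv_cos_sub_inv_cos {t : ℂ} (h1 : -Real.pi < t.re) (h2 : t.re < Real.pi) (x : ℝ) :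
    1 / cos (t / 2 + x * I) - 1 / cos (t / 2 + (-x : ℝ) * I) =
      4 * I * sin (t / 2) * sinhQuot t x := by
  have c1 := cos_half_add_ne_zero h1 h2 x
  have c2 := cos_half_add_ne_zero h1 h2 (-x)
  rw [sinhQuot, cos_add_cosh_eq, div_sub_div _ _ c1 c2, ← mul_div_assoc, div_eq_div_iff
    (mul_ne_zero c1 c2) (mul_ne_zero (mul_ne_zero two_ne_zero c1) c2)]
  rw [cos_half_add_neg, cos_half_add]
  ring

lemma inv_cos_add_inv_cos {t : ℂ} (h1 : -Real.pi < t.re) (h2 : t.re < Real.pi) (x : ℝ) :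
    1 / cos (t / 2 + x * I) + 1 / cos (t / 2 + (-x : ℝ) * I) =
      4 * cos (t / 2) * coshQuot t x := by
  have c1 := cos_half_add_ne_zero h1 h2 x
  have c2 := cos_half_add_ne_zero h1 h2 (-x)
  rw [coshQuot, cos_add_cosh_eq, div_add_div _ _ c1 c2, ← mul_div_assoc, div_eq_div_iff
    (mul_ne_zero c1 c2) (mul_ne_zero (mul_ne_zero two_ne_zero c1) c2)]
  rw [cos_half_add_neg, cos_half_add]
  ring

/-- Partial fractions of the secant. -/
lemma hasSum_two_pi_mul_inv_cos {z : ℂ} (hz : cos z ≠ 0) :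
    HasSum (fun n : ℕ => (1 / ((n : ℂ) + (1 / 4 + z / (2 * Real.pi))) -
        1 / ((n : ℂ) + (3 / 4 - z / (2 * Real.pi)))) -
        (1 / ((n : ℂ) + (3 / 4 + z / (2 * Real.pi))) -
        1 / ((n : ℂ) + (1 / 4 - z / (2 * Real.pi)))))
      (2 * Real.pi * (1 / cos z)) := by
  have e0 : (Real.pi : ℂ) ≠ 0 := ofReal_ne_zero.2 Real.pi_ne_zero
  -- With this A, cot A - cot(A + π/2) = 1/(sin A cos A) = 2/cos z, so two cotangent expansions give
  -- the secant.
  set A : ℂ := Real.pi / 4 + z / 2 with hA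
  have hsc : 2 * (sin A * cos A) = cos z := by
    rw [← mul_assoc, ← sin_two_mul, hA, show 2 * ((Real.pi : ℂ) / 4 + z / 2) = z + Real.pi / 2 by ring,
      sin_add_pi_div_two]
  have hs : sin A ≠ 0 := fun h => hz (by rw [← hsc, h]; ring)
  have hc : cos A ≠ 0 := fun h => hz (by rw [← hsc, h]; ring)
  have hw1 : (Real.pi : ℂ) * (1 / 4 + z / (2 * Real.pi)) = A := by rw [hA]; field_simp
  have hw3 : (Real.pi : ℂ) * (3 / 4 + z / (2 * Real.pi)) = A + Real.pi / 2 := by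
    rw [hA]; field_simp; ring
  have m1 : (1 / 4 + z / (2 * Real.pi)) ∈ integerComplement := by
    rintro ⟨m, hm⟩
    apply hs
    rw [← hw1, ← hm, mul_comm]
    exact sin_int_mul_pi m
  have m3 : (3 / 4 + z / (2 * Real.pi)) ∈ integerComplement := by
    rintro ⟨m, hm⟩
    apply hc
    rw [← sin_add_pi_div_two, ← hw3, ← hm, mul_comm]
    exact sin_int_mul_pi m
  convert! (hasSum_pi_mul_cot m1).sub (hasSum_pi_mul_cot m3) using 1
  · ext n; ring_nf
  · rw [hw1, hw3, cot, cot, sin_add_pi_div_two, cos_add_pi_div_two, ← hsc]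
    field_simp
    rw [sub_neg_eq_add, add_comm, sin_sq_add_cos_sq]

lemma sq_add_sq_ne_zero {A : ℂ} (hA : 0 < A.re) (ξ : ℝ) : A ^ 2 + (ξ : ℂ) ^ 2 ≠ 0 := by
  have h1 : A + ξ * I ≠ 0 := ne_zero_of_re_pos (by rw [add_ofReal_mul_I_re]; exact hA)
  have h2 : A + (-ξ : ℝ) * I ≠ 0 := ne_zero_of_re_pos (by rw [add_ofReal_mul_I_re]; exact hA)
  have : A ^ 2 + (ξ : ℂ) ^ 2 = (A + ξ * I) * (A + (-ξ : ℝ) * I) := by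
    push_cast; linear_combination (ξ : ℂ) ^ 2 * I_sq
  rw [this]; exact mul_ne_zero h1 h2

lemma one_div_add_mul_I {A : ℂ} (hA : 0 < A.re) (ξ : ℝ) :
    1 / (A + ξ * I) = (A - ξ * I) / (A ^ 2 + (ξ : ℂ) ^ 2) := by
  have h1 : A + ξ * I ≠ 0 := ne_zero_of_re_pos (by rw [add_ofReal_mul_I_re]; exact hA)
  rw [div_eq_div_iff h1 (sq_add_sq_ne_zero hA ξ)]
  linear_combination (ξ : ℂ) ^ 2 * I_sq

/-- At z = t/2 + 2πiξ the four denominators become n + a ± iξ; rationalising them separates the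
terms even and odd in ξ. -/
lemma hasSum_inv_cos_hurwitzArg {t : ℂ} (h1 : -Real.pi < t.re) (h2 : t.re < Real.pi) (ξ : ℝ) :
    HasSum (fun n : ℕ => ∑ i, (signCosh i * ((n : ℂ) + hurwitzArg t i) + signSinh i * (ξ * I)) /
        (((n : ℂ) + hurwitzArg t i) ^ 2 + (ξ : ℂ) ^ 2))
      (2 * Real.pi * (1 / cos (t / 2 + (2 * Real.pi * ξ : ℝ) * I))) := by
  have e0 : (Real.pi : ℂ) ≠ 0 := ofReal_ne_zero.2 Real.pi_ne_zero
  have h := hasSum_two_pi_mul_inv_cos (cos_half_add_ne_zero h1 h2 (2 * Real.pi * ξ))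
  convert! h using 1
  ext n
  have hre := fun i => natCast_add_re_pos (hurwitzArg_re_pos h1 h2 i) n
  set A := hurwitzArg t with hA
  have f0 : (n : ℂ) + (1 / 4 - (t / 2 + (2 * Real.pi * ξ : ℝ) * I) / (2 * Real.pi)) =
      (n + A 0) + (-ξ : ℝ) * I := by
    simp only [hA, hurwitzArg, Matrix.cons_val]; push_cast; field_simp; ring
  have f1 : (n : ℂ) + (1 / 4 + (t / 2 + (2 * Real.pi * ξ : ℝ) * I) / (2 * Real.pi)) =
      (n + A 1) + ξ * I := by
    simp only [hA, hurwitzArg, Matrix.cons_val]; push_cast; field_simp; ring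
  have f2 : (n : ℂ) + (3 / 4 - (t / 2 + (2 * Real.pi * ξ : ℝ) * I) / (2 * Real.pi)) =
      (n + A 2) + (-ξ : ℝ) * I := by
    simp only [hA, hurwitzArg, Matrix.cons_val]; push_cast; field_simp; ring
  have f3 : (n : ℂ) + (3 / 4 + (t / 2 + (2 * Real.pi * ξ : ℝ) * I) / (2 * Real.pi)) =
      (n + A 3) + ξ * I := by
    simp only [hA, hurwitzArg, Matrix.cons_val]; push_cast; field_simp; ring
  rw [f0, f1, f2, f3, one_div_add_mul_I (hre 0), one_div_add_mul_I (hre 1),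
    one_div_add_mul_I (hre 2), one_div_add_mul_I (hre 3)]
  simp only [Fin.sum_univ_four, signCosh, signSinh, Matrix.cons_val]
  push_cast
  ring

lemma hasSum_sinhQuot {t : ℂ} (h1 : -Real.pi < t.re) (h2 : t.re < Real.pi) (ξ : ℝ) :
    HasSum (fun n : ℕ => (ξ : ℂ) * ∑ i, signSinh i / (((n : ℂ) + hurwitzArg t i) ^ 2 + (ξ : ℂ) ^ 2))
      (4 * Real.pi * sin (t / 2) * sinhQuot t (2 * Real.pi * ξ)) := by
  have h := (hasSum_inv_cos_hurwitzArg h1 h2 ξ).sub (hasSum_inv_cos_hurwitzArg h1 h2 (-ξ))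
  rw [← mul_sub, show 2 * Real.pi * -ξ = -(2 * Real.pi * ξ) by ring,
    inv_cos_sub_inv_cos h1 h2] at h
  convert! h.mul_left (-I / 2) using 1
  · ext n
    rw [← Finset.sum_sub_distrib, Finset.mul_sum, Finset.mul_sum]
    refine Finset.sum_congr rfl fun i _ => ?_
    push_cast
    rw [neg_sq]
    linear_combination ((ξ : ℂ) * signSinh i / (((n : ℂ) + hurwitzArg t i) ^ 2 + (ξ : ℂ) ^ 2)) * I_sq
  · linear_combination (4 * Real.pi * sin (t / 2) * sinhQuot t (2 * Real.pi * ξ)) * I_sq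

lemma hasSum_coshQuot {t : ℂ} (h1 : -Real.pi < t.re) (h2 : t.re < Real.pi) (ξ : ℝ) :
    HasSum (fun n : ℕ => ∑ i, signCosh i * ((n : ℂ) + hurwitzArg t i) /
        (((n : ℂ) + hurwitzArg t i) ^ 2 + (ξ : ℂ) ^ 2))
      (4 * Real.pi * cos (t / 2) * coshQuot t (2 * Real.pi * ξ)) := by
  have h := (hasSum_inv_cos_hurwitzArg h1 h2 ξ).add (hasSum_inv_cos_hurwitzArg h1 h2 (-ξ))
  rw [← mul_add, show 2 * Real.pi * -ξ = -(2 * Real.pi * ξ) by ring,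
    inv_cos_add_inv_cos h1 h2] at h
  convert! h.mul_left (1 / 2) using 1
  · ext n
    rw [← Finset.sum_add_distrib, Finset.mul_sum]
    refine Finset.sum_congr rfl fun i _ => ?_
    push_cast
    rw [neg_sq]
    ring
  · ring

/-- Termwise, A/(A² + ξ²) - 1/A = -ξ²/(A(A² + ξ²)). Without this subtraction the exchange with the
Mellin integral at k + 1 would require Re k < -1 for summability and Re k > -1 for convergence of
each term at 0. -/
lemma hasSum_coshQuot_sub {t : ℂ} (h1 : -Real.pi < t.re) (h2 : t.re < Real.pi) (ξ : ℝ) :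
    HasSum (fun n : ℕ => -(ξ : ℂ) ^ 2 * ∑ i, signCosh i / ((n : ℂ) + hurwitzArg t i) /
        (((n : ℂ) + hurwitzArg t i) ^ 2 + (ξ : ℂ) ^ 2))
      (4 * Real.pi * cos (t / 2) * (coshQuot t (2 * Real.pi * ξ) - coshQuot t 0)) := by
  have h := (hasSum_coshQuot h1 h2 ξ).sub (hasSum_coshQuot h1 h2 0)
  rw [← mul_sub, mul_zero] at h
  convert! h using 1
  ext n
  rw [← Finset.sum_sub_distrib, Finset.mul_sum]
  refine Finset.sum_congr rfl fun i _ => ?_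
  have hre := natCast_add_re_pos (hurwitzArg_re_pos h1 h2 i) n
  have hA := ne_zero_of_re_pos hre
  have hB := sq_add_sq_ne_zero hre ξ
  generalize (n : ℂ) + hurwitzArg t i = A at *
  simp only [ofReal_zero]
  field_simp
  ring

/-! ### Growth bounds, holomorphy of the Mellin transforms, integration by parts -/

/-- `sinh x sinh 2x / (cos t + cosh 2x) ^ 2` -/
noncomputable def sinhMulSinhQuot (t : ℂ) (x : ℝ) : ℂ :=
  sinh x * sinh (2 * x) / (cos t + cosh (2 * x)) ^ 2

lemma integral_hypIntegrand (k t : ℂ) :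
    ∫ x in Ioi (0 : ℝ), hypIntegrand k t x = mellin (sinhMulSinhQuot t) (k + 1) := by
  unfold mellin hypIntegrand sinhMulSinhQuot
  simp only [add_sub_cancel_right, smul_eq_mul, mul_div_assoc, mul_assoc]

section Bounds

variable {t : ℂ}

lemma continuous_inv_cos_add_cosh (h1 : -Real.pi < t.re) (h2 : t.re < Real.pi) :
    Continuous fun x : ℝ => (cos t + cosh (2 * x))⁻¹ :=
  Continuous.inv₀ (by fun_prop) (cos_add_cosh_ne_zero h1 h2)

lemma continuous_sinhQuot (h1 : -Real.pi < t.re) (h2 : t.re < Real.pi) :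
    Continuous (sinhQuot t) :=
  Continuous.div (by fun_prop) (by fun_prop) (cos_add_cosh_ne_zero h1 h2)

lemma continuous_coshQuot (h1 : -Real.pi < t.re) (h2 : t.re < Real.pi) :
    Continuous (coshQuot t) :=
  Continuous.div (by fun_prop) (by fun_prop) (cos_add_cosh_ne_zero h1 h2)

lemma continuous_sinhMulSinhQuot (h1 : -Real.pi < t.re) (h2 : t.re < Real.pi) :
    Continuous (sinhMulSinhQuot t) :=
  Continuous.div (by fun_prop) (by fun_prop) fun x => pow_ne_zero 2 (cos_add_cosh_ne_zero h1 h2 x)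

lemma inv_cos_add_cosh_isBigO_top (t : ℂ) :
    (fun x : ℝ => (cos t + cosh (2 * x))⁻¹) =O[atTop] fun x : ℝ => Real.exp (-2 * x) := by
  refine Asymptotics.IsBigO.of_bound 4 ?_
  have hlim : Tendsto (fun x : ℝ => Real.exp (2 * x)) atTop atTop :=
    Real.tendsto_exp_atTop.comp (tendsto_id.const_mul_atTop two_pos)
  filter_upwards [hlim.eventually_ge_atTop (4 * ‖cos t‖)] with x hx
  have hc : cosh (2 * (x : ℂ)) = ((Real.cosh (2 * x) : ℝ) : ℂ) := by push_cast; rfl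
  have hc1 : Real.exp (2 * x) / 2 ≤ Real.cosh (2 * x) := by
    rw [Real.cosh_eq]; linarith [Real.exp_pos (-(2 * x))]
  have h1 : ‖cosh (2 * (x : ℂ))‖ - ‖cos t‖ ≤ ‖cos t + cosh (2 * x)‖ := by
    have := norm_sub_le (cos t + cosh (2 * x)) (cos t)
    rw [add_sub_cancel_left] at this
    linarith
  rw [hc, norm_real, Real.norm_of_nonneg (Real.cosh_pos _).le, ← hc] at h1
  have h2 : Real.exp (2 * x) / 4 ≤ ‖cos t + cosh (2 * x)‖ := by linarith
  rw [norm_inv, Real.norm_of_nonneg (Real.exp_pos _).le, show -2 * x = -(2 * x) by ring, Real.exp_neg]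
  calc _ ≤ (Real.exp (2 * x) / 4)⁻¹ := by gcongr
    _ = _ := by rw [inv_div, div_eq_mul_inv]

lemma sinh_isBigO_top (c : ℝ) (hc : 0 < c) :
    (fun x : ℝ => sinh (c * x : ℂ)) =O[atTop] fun x : ℝ => Real.exp (c * x) := by
  refine Asymptotics.IsBigO.of_bound 1 ?_
  filter_upwards [eventually_ge_atTop 0] with x hx
  have e : sinh (c * x : ℂ) = ((Real.sinh (c * x) : ℝ) : ℂ) := by push_cast; rfl
  have h0 : 0 ≤ c * x := by positivity
  rw [e, norm_real, Real.norm_of_nonneg (Real.sinh_nonneg_iff.2 h0),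
    Real.norm_of_nonneg (Real.exp_pos _).le, Real.sinh_eq]
  linarith [Real.exp_pos (c * x), Real.exp_pos (-(c * x))]

lemma cosh_isBigO_top : (fun x : ℝ => cosh (x : ℂ)) =O[atTop] fun x : ℝ => Real.exp x := by
  refine Asymptotics.IsBigO.of_bound 1 ?_
  filter_upwards [eventually_ge_atTop 0] with x hx
  have e : cosh (x : ℂ) = ((Real.cosh x : ℝ) : ℂ) := by push_cast; rfl
  rw [e, norm_real, Real.norm_of_nonneg (Real.cosh_pos _).le,
    Real.norm_of_nonneg (Real.exp_pos _).le, Real.cosh_eq]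
  have : Real.exp (-x) ≤ Real.exp x := Real.exp_le_exp.2 (by linarith)
  linarith

lemma sinhQuot_isBigO_top (t : ℂ) :
    sinhQuot t =O[atTop] fun x : ℝ => Real.exp (-1 * x) := by
  have h := (sinh_isBigO_top 1 one_pos).mul (inv_cos_add_cosh_isBigO_top t)
  refine h.congr (fun x => by simp [sinhQuot, div_eq_mul_inv]) fun x => ?_
  rw [← Real.exp_add]; ring_nf

lemma coshQuot_isBigO_top (t : ℂ) :
    coshQuot t =O[atTop] fun x : ℝ => Real.exp (-1 * x) := by
  have h := cosh_isBigO_top.mul (inv_cos_add_cosh_isBigO_top t)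
  refine h.congr (fun x => by simp [coshQuot, div_eq_mul_inv]) fun x => ?_
  rw [← Real.exp_add]; ring_nf

lemma sinhMulSinhQuot_isBigO_top (t : ℂ) :
    sinhMulSinhQuot t =O[atTop] fun x : ℝ => Real.exp (-1 * x) := by
  have h := ((sinh_isBigO_top 1 one_pos).mul (sinh_isBigO_top 2 two_pos)).mul
    ((inv_cos_add_cosh_isBigO_top t).mul (inv_cos_add_cosh_isBigO_top t))
  refine h.congr (fun x => ?_) fun x => ?_
  · simp [sinhMulSinhQuot, div_eq_mul_inv, sq]
  · rw [← Real.exp_add, ← Real.exp_add, ← Real.exp_add]; ring_nf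

lemma sinh_isBigO_zero (c : ℝ) :
    (fun x : ℝ => sinh (c * x : ℂ)) =O[𝓝[>] 0] fun x : ℝ => x := by
  have h : DifferentiableAt ℝ (fun x : ℝ => sinh (c * x : ℂ)) 0 := by
    have h1 : DifferentiableAt ℂ (fun z : ℂ => sinh (c * z)) ((0 : ℝ) : ℂ) := by fun_prop
    exact h1.hasDerivAt.comp_ofReal.differentiableAt
  simpa using h.isBigO_sub.mono nhdsWithin_le_nhds

lemma inv_cos_add_cosh_isBigO_zero (h1 : -Real.pi < t.re) (h2 : t.re < Real.pi) :
    (fun x : ℝ => (cos t + cosh (2 * x))⁻¹) =O[𝓝[>] 0] fun _ : ℝ => (1 : ℝ) :=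
  ((continuous_inv_cos_add_cosh h1 h2).continuousAt.isBigO_one ℝ).mono nhdsWithin_le_nhds

lemma sinhQuot_isBigO_zero (h1 : -Real.pi < t.re) (h2 : t.re < Real.pi) :
    sinhQuot t =O[𝓝[>] 0] fun x : ℝ => x ^ (-(-1 : ℝ)) := by
  have h := (sinh_isBigO_zero 1).mul (inv_cos_add_cosh_isBigO_zero h1 h2)
  exact h.congr (fun x => by simp [sinhQuot, div_eq_mul_inv]) fun x => by simp

lemma coshQuot_isBigO_zero (h1 : -Real.pi < t.re) (h2 : t.re < Real.pi) :
    coshQuot t =O[𝓝[>] 0] fun x : ℝ => x ^ (-(0 : ℝ)) := by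
  simpa using ((continuous_coshQuot h1 h2).continuousAt.isBigO_one ℝ).mono
    (nhdsWithin_le_nhds (a := (0 : ℝ)) (s := Ioi 0))

/-- The double zero at the origin is what allows Re k down to -3. -/
lemma sinhMulSinhQuot_isBigO_zero (h1 : -Real.pi < t.re) (h2 : t.re < Real.pi) :
    sinhMulSinhQuot t =O[𝓝[>] 0] fun x : ℝ => x ^ (-(-2 : ℝ)) := by
  have h := ((sinh_isBigO_zero 1).mul (sinh_isBigO_zero 2)).mul
    ((inv_cos_add_cosh_isBigO_zero h1 h2).mul (inv_cos_add_cosh_isBigO_zero h1 h2))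
  refine h.congr (fun x => ?_) fun x => ?_
  · simp [sinhMulSinhQuot, div_eq_mul_inv, sq]
  · rw [neg_neg, Real.rpow_two]; ring

lemma mellinConvergent_sinhQuot (h1 : -Real.pi < t.re) (h2 : t.re < Real.pi) {s : ℂ}
    (hs : -1 < s.re) : MellinConvergent (sinhQuot t) s :=
  mellinConvergent_of_isBigO_rpow_exp one_pos
    ((continuous_sinhQuot h1 h2).locallyIntegrable.locallyIntegrableOn _)
    (sinhQuot_isBigO_top t) (sinhQuot_isBigO_zero h1 h2) hs

lemma mellinConvergent_coshQuot (h1 : -Real.pi < t.re) (h2 : t.re < Real.pi) {s : ℂ}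
    (hs : 0 < s.re) : MellinConvergent (coshQuot t) s :=
  mellinConvergent_of_isBigO_rpow_exp one_pos
    ((continuous_coshQuot h1 h2).locallyIntegrable.locallyIntegrableOn _)
    (coshQuot_isBigO_top t) (coshQuot_isBigO_zero h1 h2) hs

lemma mellinConvergent_sinhMulSinhQuot (h1 : -Real.pi < t.re) (h2 : t.re < Real.pi) {s : ℂ}
    (hs : -2 < s.re) : MellinConvergent (sinhMulSinhQuot t) s :=
  mellinConvergent_of_isBigO_rpow_exp one_pos
    ((continuous_sinhMulSinhQuot h1 h2).locallyIntegrable.locallyIntegrableOn _)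
    (sinhMulSinhQuot_isBigO_top t) (sinhMulSinhQuot_isBigO_zero h1 h2) hs

lemma differentiableAt_mellin_sinhQuot (h1 : -Real.pi < t.re) (h2 : t.re < Real.pi) {s : ℂ}
    (hs : -1 < s.re) : DifferentiableAt ℂ (mellin (sinhQuot t)) s :=
  mellin_differentiableAt_of_isBigO_rpow_exp one_pos
    ((continuous_sinhQuot h1 h2).locallyIntegrable.locallyIntegrableOn _)
    (sinhQuot_isBigO_top t) (sinhQuot_isBigO_zero h1 h2) hs

lemma differentiableAt_mellin_coshQuot (h1 : -Real.pi < t.re) (h2 : t.re < Real.pi) {s : ℂ}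
    (hs : 0 < s.re) : DifferentiableAt ℂ (mellin (coshQuot t)) s :=
  mellin_differentiableAt_of_isBigO_rpow_exp one_pos
    ((continuous_coshQuot h1 h2).locallyIntegrable.locallyIntegrableOn _)
    (coshQuot_isBigO_top t) (coshQuot_isBigO_zero h1 h2) hs

lemma differentiableAt_mellin_sinhMulSinhQuot (h1 : -Real.pi < t.re) (h2 : t.re < Real.pi) {s : ℂ}
    (hs : -2 < s.re) : DifferentiableAt ℂ (mellin (sinhMulSinhQuot t)) s :=
  mellin_differentiableAt_of_isBigO_rpow_exp one_pos
    ((continuous_sinhMulSinhQuot h1 h2).locallyIntegrable.locallyIntegrableOn _)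
    (sinhMulSinhQuot_isBigO_top t) (sinhMulSinhQuot_isBigO_zero h1 h2) hs

lemma tendsto_cpow_mul_sinhQuot (t k : ℂ) :
    Tendsto (fun x : ℝ => (x : ℂ) ^ k * sinhQuot t x) atTop (𝓝 0) := by
  have hc : (fun x : ℝ => (x : ℂ) ^ k) =O[atTop] fun x : ℝ => x ^ k.re := by
    refine Asymptotics.IsBigO.of_bound 1 ?_
    filter_upwards [eventually_gt_atTop 0] with x hx
    rw [norm_cpow_eq_rpow_re_of_pos hx, one_mul]
    exact le_abs_self _
  have hO := (hc.mul (sinhQuot_isBigO_top t)).trans_tendsto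
    (by simpa using tendsto_rpow_mul_exp_neg_mul_atTop_nhds_zero k.re 1 one_pos)
  exact hO

/-- Integration by parts. -/
lemma mellin_sinhMulSinhQuot_eq (h1 : -Real.pi < t.re) (h2 : t.re < Real.pi) {k : ℂ}
    (hk : 0 < k.re) : mellin (sinhMulSinhQuot t) (k + 1) =
      (k * mellin (sinhQuot t) k + mellin (coshQuot t) (k + 1)) / 2 := by
  have hk0 := ne_zero_of_re_pos hk
  have i1 : IntegrableOn (fun x : ℝ => (x : ℂ) ^ (k + 1 - 1) • sinhMulSinhQuot t x) (Ioi 0) :=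
    mellinConvergent_sinhMulSinhQuot h1 h2 (by simp; linarith)
  have i2 : IntegrableOn (fun x : ℝ => (x : ℂ) ^ (k - 1) • sinhQuot t x) (Ioi 0) :=
    mellinConvergent_sinhQuot h1 h2 (by linarith)
  have i3 : IntegrableOn (fun x : ℝ => (x : ℂ) ^ (k + 1 - 1) • coshQuot t x) (Ioi 0) :=
    mellinConvergent_coshQuot h1 h2 (by simp; linarith)
  -- The derivative of this product contains all three integrands; Re k > 0 makes it continuous with
  -- value 0 at the origin, and it decays at infinity, so its integral vanishes.
  set f : ℝ → ℂ := fun x => (x : ℂ) ^ k * sinhQuot t x with hf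
  set f' : ℝ → ℂ := fun x => k * ((x : ℂ) ^ (k - 1) • sinhQuot t x) +
    ((x : ℂ) ^ (k + 1 - 1) • coshQuot t x) - 2 * ((x : ℂ) ^ (k + 1 - 1) • sinhMulSinhQuot t x)
    with hf'
  have hcont : ContinuousWithinAt f (Ici 0) 0 := by
    refine ContinuousAt.continuousWithinAt (ContinuousAt.mul ?_
      (continuous_sinhQuot h1 h2).continuousAt)
    exact continuousAt_ofReal_cpow_const _ _ (Or.inl hk)
  have hderiv : ∀ x ∈ Ioi (0 : ℝ), HasDerivAt f (f' x) x := by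
    intro x hx
    have hx0 : (x : ℂ) ≠ 0 := ofReal_ne_zero.2 (ne_of_gt hx)
    have hD := cos_add_cosh_ne_zero h1 h2 x
    have d1 : HasDerivAt (fun z : ℂ => z ^ k) (k * (x : ℂ) ^ (k - 1)) (x : ℂ) := by
      simpa using (hasDerivAt_id (x : ℂ)).cpow_const (c := k) (Or.inl (by simpa using hx))
    have d2 : HasDerivAt (fun z : ℂ => cos t + cosh (2 * z)) (sinh (2 * x) * 2) (x : ℂ) := by
      have := (((hasDerivAt_id (x : ℂ)).const_mul 2).ccosh).const_add (cos t)
      simpa using this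
    have d3 := ((d1.mul ((hasDerivAt_sinh (x : ℂ)).div d2 hD))).comp_ofReal
    convert! d3 using 1
    simp only [hf', sinhQuot, coshQuot, sinhMulSinhQuot, smul_eq_mul, Pi.div_apply, add_sub_cancel_right]
    field_simp
    ring
  have h := integral_Ioi_of_hasDerivAt_of_tendsto hcont hderiv
    (((i2.const_mul k).add i3).sub (i1.const_mul 2)) (tendsto_cpow_mul_sinhQuot t k)
  have i23 : IntegrableOn (fun x : ℝ => k * ((x : ℂ) ^ (k - 1) • sinhQuot t x) +
    ((x : ℂ) ^ (k + 1 - 1) • coshQuot t x)) (Ioi 0) := (i2.const_mul k).add i3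
  rw [hf', integral_sub i23 (i1.const_mul 2), integral_add (i2.const_mul k) i3,
    integral_const_mul, integral_const_mul] at h
  have hf0 : f 0 = 0 := by simp [hf, hk0]
  rw [hf0, sub_zero] at h
  simp only [mellin]
  linear_combination -h / 2

end Bounds

/-! ### Mellin transform of the sinh quotient -/

lemma pi_half_re (k : ℂ) : (Real.pi * k / 2).re = Real.pi * k.re / 2 := by
  rw [half_re, re_ofReal_mul]

lemma cos_pi_half_ne_zero {k : ℂ} (h1 : -1 < k.re) (h2 : k.re < 1) :
    cos (Real.pi * k / 2) ≠ 0 := by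
  have hpi := Real.pi_pos
  refine cos_ne_zero_of_abs_re_lt ?_ ?_ <;> rw [pi_half_re] <;> nlinarith

lemma one_div_mul_cpow_add_one {A k : ℂ} (hA : A ≠ 0) : 1 / A * A ^ (k + 1) = A ^ k := by
  rw [cpow_add _ _ hA, cpow_one]; field_simp

lemma tsum_hurwitz {s a : ℂ} (hs : 1 < s.re) (ha : 0 < a.re) :
    (s - 1) * ∑' n : ℕ, ((n : ℂ) + a) ^ (-s) = hurwitzEntire s a := by
  have hs1 : s - 1 ≠ 0 := by
    intro h; rw [sub_eq_zero] at h; rw [h] at hs; simp at hs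
  rw [(hasSum_hurwitz hs ha).tsum_eq]
  field_simp

section

variable {t : ℂ}

/-- Re k > -1 gives convergence of each term at 0, and Re k < 0 puts 1 - k in the half-plane of the
Dirichlet series. The factor ξ in `hasSum_sinhQuot` accounts for the shift from k to k + 1. -/
lemma mellin_sinhQuot_strip (h1 : -Real.pi < t.re) (h2 : t.re < Real.pi) {k : ℂ}
    (hk1 : -1 < k.re) (hk2 : k.re < 0) :
    k * cos (Real.pi * k / 2) * (sin (t / 2) * mellin (fun ξ => sinhQuot t (2 * Real.pi * ξ)) k) =
      -(∑ i, signSinh i * hurwitzEntire (1 - k) (hurwitzArg t i)) / 8 := by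
  have hpi : (Real.pi : ℂ) ≠ 0 := ofReal_ne_zero.2 Real.pi_ne_zero
  have ha := hurwitzArg_re_pos h1 h2
  have hc := cos_pi_half_ne_zero hk1 (by linarith)
  have hsum := mellin_tsum_sum_div_sq_add_sq ha (c := fun i _ => signSinh i) hk1
    (by linarith) (fun i => (summable_natCast_add_rpow (ha i) (by linarith)).mul_left _)
  have hL : 4 * Real.pi * (sin (t / 2) * mellin (fun ξ => sinhQuot t (2 * Real.pi * ξ)) k) =
      mellin (fun x : ℝ => ∑' n : ℕ, ∑ i, signSinh i / (((n : ℂ) + hurwitzArg t i) ^ 2 +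
        (x : ℂ) ^ 2)) (k + 1) := by
    rw [← mul_assoc]
    unfold mellin
    rw [← integral_const_mul]
    refine setIntegral_congr_fun measurableSet_Ioi fun x hx => ?_
    have hx0 : (x : ℂ) ≠ 0 := ofReal_ne_zero.2 (ne_of_gt hx)
    have h := (hasSum_sinhQuot h1 h2 x).tsum_eq
    rw [tsum_mul_left] at h
    simp only [smul_eq_mul, add_sub_cancel_right]
    rw [mul_left_comm, ← h, cpow_sub _ _ hx0, cpow_one]
    field_simp
  have hz : ∀ i, ∑' n : ℕ, signSinh i * ((n : ℂ) + hurwitzArg t i) ^ (k - 1) =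
      signSinh i * ∑' n : ℕ, ((n : ℂ) + hurwitzArg t i) ^ (-(1 - k)) := fun i => by
    rw [tsum_mul_left, neg_sub]
  rw [hsum] at hL
  simp only [hz] at hL
  have hZ : ∀ i, -k * ∑' n : ℕ, ((n : ℂ) + hurwitzArg t i) ^ (-(1 - k)) =
      hurwitzEntire (1 - k) (hurwitzArg t i) := fun i => by
    rw [← tsum_hurwitz (by simp; linarith) (ha i)]; ring
  have hS : ∑ i, signSinh i * hurwitzEntire (1 - k) (hurwitzArg t i) =
      -k * ∑ i, signSinh i * ∑' n : ℕ, ((n : ℂ) + hurwitzArg t i) ^ (-(1 - k)) := by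
    rw [Finset.mul_sum]
    refine Finset.sum_congr rfl fun i _ => ?_
    rw [← hZ i]; ring
  rw [hS]
  generalize ∑ i, signSinh i * ∑' n : ℕ, ((n : ℂ) + hurwitzArg t i) ^ (-(1 - k)) = S at *
  generalize sin (t / 2) * mellin (fun ξ => sinhQuot t (2 * Real.pi * ξ)) k = M at *
  generalize cos (Real.pi * k / 2) = c at *
  have : M = S / (8 * c) := by
    rw [eq_div_iff (by simpa using hc)]
    field_simp at hL
    linear_combination hL
  rw [this]
  field_simp

lemma differentiable_sum_hurwitzEntire (h1 : -Real.pi < t.re) (h2 : t.re < Real.pi)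
    (ε : Fin 4 → ℂ) : Differentiable ℂ fun s => ∑ i, ε i * hurwitzEntire s (hurwitzArg t i) :=
  Differentiable.fun_sum fun i _ =>
    (differentiable_hurwitzEntire (hurwitzArg_re_pos h1 h2 i)).const_mul _

lemma mellin_sinhQuot_comp (t k : ℂ) :
    mellin (fun ξ => sinhQuot t (2 * Real.pi * ξ)) k =
      ((2 * Real.pi : ℝ) : ℂ) ^ (-k) * mellin (sinhQuot t) k :=
  mellin_comp_mul_left (sinhQuot t) k Real.two_pi_pos

lemma mellin_coshQuot_comp (t k : ℂ) :
    mellin (fun ξ => coshQuot t (2 * Real.pi * ξ)) k =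
      ((2 * Real.pi : ℝ) : ℂ) ^ (-k) * mellin (coshQuot t) k :=
  mellin_comp_mul_left (coshQuot t) k Real.two_pi_pos

lemma two_pi_ne_zero' : ((2 * Real.pi : ℝ) : ℂ) ≠ 0 := ofReal_ne_zero.2 Real.two_pi_pos.ne'

/-- The Mellin transform of `sinh x / (cos t + cosh 2x)`. -/
lemma mellin_sinhQuot (h1 : -Real.pi < t.re) (h2 : t.re < Real.pi) {k : ℂ} (hk : -1 < k.re) :
    k * cos (Real.pi * k / 2) * (sin (t / 2) *
      (((2 * Real.pi : ℝ) : ℂ) ^ (-k) * mellin (sinhQuot t) k)) =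
      -(∑ i, signSinh i * hurwitzEntire (1 - k) (hurwitzArg t i)) / 8 := by
  refine eqOn_of_eqOn_open (U := {z | -1 < z.re}) (V := {z | -1 < z.re ∧ z.re < 0})
    (f := fun k => k * cos (Real.pi * k / 2) * (sin (t / 2) *
      (((2 * Real.pi : ℝ) : ℂ) ^ (-k) * mellin (sinhQuot t) k)))
    (g := fun k => -(∑ i, signSinh i * hurwitzEntire (1 - k) (hurwitzArg t i)) / 8)
    (isOpen_re_gt _) (isPreconnected_re_gt _) ?_ ?_ (isOpen_re_strip _ _)
    (fun z hz => hz.1) ⟨((-1 / 2 : ℝ) : ℂ), by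
      simp only [mem_ofPred_eq, ofReal_re]; norm_num⟩ (fun z hz => ?_) hk
  · intro z hz
    have hm := differentiableAt_mellin_sinhQuot h1 h2 hz
    have hp : DifferentiableAt ℂ (fun k : ℂ => ((2 * Real.pi : ℝ) : ℂ) ^ (-k)) z :=
      DifferentiableAt.const_cpow (by fun_prop) (Or.inl two_pi_ne_zero')
    exact DifferentiableAt.differentiableWithinAt (by fun_prop)
  · have := (differentiable_sum_hurwitzEntire h1 h2 signSinh).comp
      (f := fun k : ℂ => 1 - k) (by fun_prop)
    exact (this.neg.div_const 8).differentiableOn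
  · simp only [← mellin_sinhQuot_comp]
    exact mellin_sinhQuot_strip h1 h2 hz.1 hz.2

/-! ### Mellin transform of the cosh quotient -/

/-- The factor ξ² from `hasSum_coshQuot_sub` moves the termwise transform to k + 2, and Re k < -1
puts -k in the half-plane of the Dirichlet series. The sign of -ξ² cancels against cos(π(k + 2)/2) =
-cos(πk/2). -/
lemma mellin_coshQuot_sub_strip (h1 : -Real.pi < t.re) (h2 : t.re < Real.pi) {k : ℂ}
    (hk1 : -3 < k.re) (hk2 : k.re < -1) :
    (k + 1) * cos (Real.pi * k / 2) * (cos (t / 2) *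
      mellin (fun ξ => coshQuot t (2 * Real.pi * ξ) - coshQuot t 0) (k + 1)) =
      -(∑ i, signCosh i * hurwitzEntire (-k) (hurwitzArg t i)) / 8 := by
  have hpi : (Real.pi : ℂ) ≠ 0 := ofReal_ne_zero.2 Real.pi_ne_zero
  have ha := hurwitzArg_re_pos h1 h2
  have hk1' : -1 < (k + 2).re := by simp; linarith
  have hk2' : (k + 2).re < 1 := by simp; linarith
  have hcos : cos (Real.pi * (k + 2) / 2) = -cos (Real.pi * k / 2) := by
    rw [show (Real.pi : ℂ) * (k + 2) / 2 = Real.pi * k / 2 + Real.pi by ring, cos_add_pi]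
  have hc := cos_pi_half_ne_zero hk1' hk2'
  rw [hcos, neg_ne_zero] at hc
  have hA := fun i (n : ℕ) => natCast_add_re_pos (ha i) n
  have hsum := mellin_tsum_sum_div_sq_add_sq ha
    (c := fun i n => signCosh i / ((n : ℂ) + hurwitzArg t i)) hk1' hk2' (fun i => by
      refine Summable.of_nonneg_of_le (fun n => ?_) (fun n => ?_)
        ((summable_natCast_add_rpow (ha i) (p := k.re) hk2).mul_left ‖signCosh i‖)
      · have := hA i n
        simp only [add_re, natCast_re] at this
        positivity
      · have hpos := hA i n
        have hle := re_le_norm ((n : ℂ) + hurwitzArg t i)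
        simp only [add_re, natCast_re] at hpos hle
        rw [norm_div]
        have e : ((n : ℝ) + (hurwitzArg t i).re) ^ ((k + 2).re - 1) =
            ((n : ℝ) + (hurwitzArg t i).re) ^ k.re * ((n : ℝ) + (hurwitzArg t i).re) := by
          rw [← Real.rpow_add_one hpos.ne']; congr 1; simp; ring
        rw [e]
        calc _ = ‖signCosh i‖ * ((n : ℝ) + (hurwitzArg t i).re) ^ k.re *
              (((n : ℝ) + (hurwitzArg t i).re) / ‖(n : ℂ) + hurwitzArg t i‖) := by ring
          _ ≤ ‖signCosh i‖ * ((n : ℝ) + (hurwitzArg t i).re) ^ k.re * 1 := by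
              gcongr
              exact div_le_one_of_le₀ hle (norm_nonneg _)
          _ = _ := mul_one _)
  have hL : 4 * Real.pi * (cos (t / 2) * mellin (fun ξ => coshQuot t (2 * Real.pi * ξ) -
      coshQuot t 0) (k + 1)) =
      -mellin (fun x : ℝ => ∑' n : ℕ, ∑ i, signCosh i / ((n : ℂ) + hurwitzArg t i) /
        (((n : ℂ) + hurwitzArg t i) ^ 2 + (x : ℂ) ^ 2)) (k + 2 + 1) := by
    rw [← mul_assoc]
    unfold mellin
    rw [← integral_const_mul, ← integral_neg]
    refine setIntegral_congr_fun measurableSet_Ioi fun x hx => ?_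
    have hx0 : (x : ℂ) ≠ 0 := ofReal_ne_zero.2 (ne_of_gt hx)
    have h := (hasSum_coshQuot_sub h1 h2 x).tsum_eq
    rw [tsum_mul_left] at h
    simp only [smul_eq_mul, add_sub_cancel_right]
    rw [mul_left_comm, ← h, cpow_add _ _ hx0, cpow_ofNat]
    ring
  have hz : ∀ i, ∑' n : ℕ, signCosh i / ((n : ℂ) + hurwitzArg t i) *
      ((n : ℂ) + hurwitzArg t i) ^ (k + 2 - 1) =
      signCosh i * ∑' n : ℕ, ((n : ℂ) + hurwitzArg t i) ^ (-(-k)) := fun i => by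
    rw [← tsum_mul_left]
    refine tsum_congr fun n => ?_
    rw [neg_neg, ← one_div_mul_cpow_add_one (k := k) (ne_zero_of_re_pos (hA i n)),
      show k + 2 - 1 = k + 1 by ring]
    ring
  rw [hsum] at hL
  simp only [hz] at hL
  have hZ : ∀ i, -(k + 1) * ∑' n : ℕ, ((n : ℂ) + hurwitzArg t i) ^ (-(-k)) =
      hurwitzEntire (-k) (hurwitzArg t i) := fun i => by
    rw [← tsum_hurwitz (by simp; linarith) (ha i)]; ring
  have hS : ∑ i, signCosh i * hurwitzEntire (-k) (hurwitzArg t i) =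
      -(k + 1) * ∑ i, signCosh i * ∑' n : ℕ, ((n : ℂ) + hurwitzArg t i) ^ (-(-k)) := by
    rw [Finset.mul_sum]
    refine Finset.sum_congr rfl fun i _ => ?_
    rw [← hZ i]; ring
  rw [hS]
  rw [hcos] at hL
  generalize ∑ i, signCosh i * ∑' n : ℕ, ((n : ℂ) + hurwitzArg t i) ^ (-(-k)) = S at *
  generalize cos (t / 2) * mellin (fun ξ => coshQuot t (2 * Real.pi * ξ) - coshQuot t 0) (k + 1) = M
    at *
  generalize cos (Real.pi * k / 2) = c at *
  have : M = S / (8 * c) := by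
    rw [eq_div_iff (by simpa using hc)]
    field_simp at hL
    linear_combination hL
  rw [this]
  field_simp

end

section

variable {t : ℂ}

lemma continuous_one_div_one_add_sq :
    Continuous fun x : ℝ => 1 / ((1 : ℂ) ^ 2 + (x : ℂ) ^ 2) :=
  Continuous.div (by fun_prop) (by fun_prop) fun x => sq_add_sq_ne_zero (by simp) x

lemma mellin_one_div_one_add_sq {k : ℂ} (hk1 : -1 < k.re) (hk2 : k.re < 1) :
    mellin (fun x : ℝ => 1 / ((1 : ℂ) ^ 2 + (x : ℂ) ^ 2)) (k + 1) =
      Real.pi / (2 * cos (Real.pi * k / 2)) := by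
  rw [mellin_one_div_sq_add_sq (by simp) hk1 hk2, one_cpow, one_mul]

/-- Here 1/(1 + x²) - 1 = -x²/(1 + x²), and the shift k ↦ k + 2 changes the sign of the cosine, so
the formula agrees with that for 1/(1 + x²) in the strip -1 < Re k < 1. This lets the cosh formula
cross Re k = -1. -/
lemma hasMellin_one_div_one_add_sq_sub_one {k : ℂ} (hk1 : -3 < k.re) (hk2 : k.re < -1) :
    HasMellin (fun x : ℝ => 1 / ((1 : ℂ) ^ 2 + (x : ℂ) ^ 2) - 1) (k + 1)
      (Real.pi / (2 * cos (Real.pi * k / 2))) := by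
  have hk1' : -1 < (k + 2).re := by simp; linarith
  have hk2' : (k + 2).re < 1 := by simp; linarith
  have hconv := mellinConvergent_one_div_sq_add_sq (A := 1) (by simp) hk1' hk2'
  have hval := mellin_one_div_one_add_sq hk1' hk2'
  have hcos : cos (Real.pi * (k + 2) / 2) = -cos (Real.pi * k / 2) := by
    rw [show (Real.pi : ℂ) * (k + 2) / 2 = Real.pi * k / 2 + Real.pi by ring, cos_add_pi]
  have hpt : EqOn (fun x : ℝ => -((x : ℂ) ^ (k + 2 + 1 - 1) • (1 / ((1 : ℂ) ^ 2 + (x : ℂ) ^ 2))))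
      (fun x : ℝ => (x : ℂ) ^ (k + 1 - 1) • (1 / ((1 : ℂ) ^ 2 + (x : ℂ) ^ 2) - 1)) (Ioi 0) := by
    intro x hx
    have hx0 : (x : ℂ) ≠ 0 := ofReal_ne_zero.2 (ne_of_gt hx)
    have h0 := sq_add_sq_ne_zero (A := 1) (by simp) x
    simp only [smul_eq_mul, add_sub_cancel_right]
    rw [cpow_add _ _ hx0, cpow_ofNat]
    rw [one_pow] at h0 ⊢
    field_simp
    ring
  refine ⟨hconv.neg.congr_fun hpt measurableSet_Ioi, ?_⟩
  rw [mellin, ← setIntegral_congr_fun measurableSet_Ioi hpt, integral_neg]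
  change -mellin _ _ = _
  rw [hval, hcos, mul_neg, div_neg, neg_neg]

lemma rpow_neg_two_bound (h : ℝ → ℂ) (hO : h =O[atTop] fun x : ℝ => Real.exp (-1 * x)) :
    (fun x => h (2 * Real.pi * x)) =O[atTop] fun x : ℝ => x ^ (-(2 : ℝ)) := by
  have ht : Tendsto (fun x : ℝ => 2 * Real.pi * x) atTop atTop :=
    tendsto_id.const_mul_atTop Real.two_pi_pos
  refine (hO.comp_tendsto ht).trans ?_
  have := (isLittleO_exp_neg_mul_rpow_atTop Real.two_pi_pos (-(2 : ℝ))).isBigO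
  refine this.congr_left fun x => ?_
  simp

/-- `cosh x / (cos t + cosh 2x)` with its value at `0` removed, keeping decay at infinity. -/
noncomputable def coshQuotRegularized (t : ℂ) (ξ : ℝ) : ℂ :=
  coshQuot t (2 * Real.pi * ξ) - coshQuot t 0 * (1 / ((1 : ℂ) ^ 2 + (ξ : ℂ) ^ 2))

lemma continuous_coshQuotRegularized (h1 : -Real.pi < t.re) (h2 : t.re < Real.pi) :
    Continuous (coshQuotRegularized t) :=
  ((continuous_coshQuot h1 h2).comp (by fun_prop)).sub
    (continuous_const.mul continuous_one_div_one_add_sq)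

lemma coshQuotRegularized_isBigO_top (t : ℂ) :
    coshQuotRegularized t =O[atTop] fun x : ℝ => x ^ (-(2 : ℝ)) := by
  refine (rpow_neg_two_bound _ (coshQuot_isBigO_top t)).sub (Asymptotics.IsBigO.const_mul_left ?_ _)
  refine Asymptotics.IsBigO.of_bound 1 ?_
  filter_upwards [eventually_gt_atTop 0] with x hx
  have e : (1 : ℂ) / ((1 : ℂ) ^ 2 + (x : ℂ) ^ 2) = ((1 / (1 + x ^ 2) : ℝ) : ℂ) := by push_cast; ring
  rw [e, norm_real, Real.norm_of_nonneg (by positivity), Real.norm_of_nonneg (by positivity),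
    Real.rpow_neg hx.le, Real.rpow_two, one_mul, one_div]
  gcongr
  linarith

lemma differentiableAt_coshQuot_comp (h1 : -Real.pi < t.re) (h2 : t.re < Real.pi) :
    DifferentiableAt ℝ (fun ξ : ℝ => coshQuot t (2 * Real.pi * ξ)) 0 := by
  have h : DifferentiableAt ℂ (fun z : ℂ => cosh (2 * Real.pi * z) /
      (cos t + cosh (2 * (2 * Real.pi * z)))) ((0 : ℝ) : ℂ) := by
    refine DifferentiableAt.div (by fun_prop) (by fun_prop) ?_
    simpa using cos_add_cosh_ne_zero h1 h2 0
  have h' := h.hasDerivAt.comp_ofReal.differentiableAt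
  refine h'.congr_of_eventuallyEq (Eventually.of_forall fun x => ?_)
  simp [coshQuot]

lemma coshQuotRegularized_isBigO_zero (h1 : -Real.pi < t.re) (h2 : t.re < Real.pi) :
    coshQuotRegularized t =O[𝓝[>] 0] fun x : ℝ => x ^ (-(-1 : ℝ)) := by
  have hd : DifferentiableAt ℝ (coshQuotRegularized t) 0 := by
    refine (differentiableAt_coshQuot_comp h1 h2).sub (DifferentiableAt.const_mul ?_ _)
    have h : DifferentiableAt ℂ (fun z : ℂ => 1 / ((1 : ℂ) ^ 2 + z ^ 2)) ((0 : ℝ) : ℂ) :=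
      DifferentiableAt.div (by fun_prop) (by fun_prop) (by simp)
    exact h.hasDerivAt.comp_ofReal.differentiableAt
  have h0 : coshQuotRegularized t 0 = 0 := by simp [coshQuotRegularized]
  have := hd.isBigO_sub.mono (nhdsWithin_le_nhds (s := Ioi 0))
  simpa [h0] using this

lemma mellinConvergent_coshQuotRegularized (h1 : -Real.pi < t.re) (h2 : t.re < Real.pi) {k : ℂ}
    (hk1 : -2 < k.re) (hk2 : k.re < 1) : MellinConvergent (coshQuotRegularized t) (k + 1) :=
  mellinConvergent_of_isBigO_rpow
    ((continuous_coshQuotRegularized h1 h2).locallyIntegrable.locallyIntegrableOn _)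
    (coshQuotRegularized_isBigO_top t) (by simp; linarith)
    (coshQuotRegularized_isBigO_zero h1 h2) (by simp; linarith)

lemma differentiableAt_mellin_coshQuotRegularized (h1 : -Real.pi < t.re) (h2 : t.re < Real.pi)
    {k : ℂ} (hk1 : -2 < k.re) (hk2 : k.re < 1) :
    DifferentiableAt ℂ (mellin (coshQuotRegularized t)) (k + 1) :=
  mellin_differentiableAt_of_isBigO_rpow
    ((continuous_coshQuotRegularized h1 h2).locallyIntegrable.locallyIntegrableOn _)
    (coshQuotRegularized_isBigO_top t) (by simp; linarith)
    (coshQuotRegularized_isBigO_zero h1 h2) (by simp; linarith)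

lemma differentiable_sum_signCosh (h1 : -Real.pi < t.re) (h2 : t.re < Real.pi) :
    Differentiable ℂ fun k => ∑ i, signCosh i * hurwitzEntire (-k) (hurwitzArg t i) :=
  (differentiable_sum_hurwitzEntire h1 h2 signCosh).comp (f := fun k : ℂ => -k) (by fun_prop)

lemma mellin_coshQuotRegularized (h1 : -Real.pi < t.re) (h2 : t.re < Real.pi) {k : ℂ}
    (hk1 : -2 < k.re) (hk2 : k.re < 1) :
    (k + 1) * cos (Real.pi * k / 2) * (cos (t / 2) * mellin (coshQuotRegularized t) (k + 1)) =
      -(∑ i, signCosh i * hurwitzEntire (-k) (hurwitzArg t i)) / 8 -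
        (k + 1) * (Real.pi / 2) * cos (t / 2) * coshQuot t 0 := by
  -- The bound -2 comes from the first-order vanishing at 0 in `coshQuotRegularized_isBigO_zero`;
  -- the resulting overlap with the strip of `mellin_coshQuot_sub_strip` is enough.
  refine eqOn_of_eqOn_open (U := {z | -2 < z.re ∧ z.re < 1}) (V := {z | -2 < z.re ∧ z.re < -1})
    (f := fun k => (k + 1) * cos (Real.pi * k / 2) *
      (cos (t / 2) * mellin (coshQuotRegularized t) (k + 1)))
    (g := fun k => -(∑ i, signCosh i * hurwitzEntire (-k) (hurwitzArg t i)) / 8 -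
        (k + 1) * (Real.pi / 2) * cos (t / 2) * coshQuot t 0)
    (isOpen_re_strip _ _) (isPreconnected_re_strip _ _) ?_ ?_ (isOpen_re_strip _ _)
    (fun z hz => ⟨hz.1, by linarith [hz.2]⟩) ⟨((-3 / 2 : ℝ) : ℂ), by
      simp only [mem_ofPred_eq, ofReal_re]; norm_num⟩ (fun z hz => ?_) ⟨hk1, hk2⟩
  · intro z hz
    have hm : DifferentiableAt ℂ (fun k => mellin (coshQuotRegularized t) (k + 1)) z :=
      (differentiableAt_mellin_coshQuotRegularized h1 h2 hz.1 hz.2).comp z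
        (f := fun k : ℂ => k + 1) (by fun_prop)
    exact DifferentiableAt.differentiableWithinAt (by fun_prop)
  · have := differentiable_sum_signCosh h1 h2
    exact Differentiable.differentiableOn (by fun_prop)
  · have hz3 : -3 < z.re := by linarith [hz.1]
    have hstrip := mellin_coshQuot_sub_strip h1 h2 hz3 hz.2
    have hr := hasMellin_one_div_one_add_sq_sub_one hz3 hz.2
    have hconv : MellinConvergent (fun ξ => coshQuot t (2 * Real.pi * ξ) - coshQuot t 0) (z + 1) := by
      refine mellinConvergent_of_isBigO_rpow (a := 0) (b := -1)
        (Continuous.locallyIntegrable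
          (((continuous_coshQuot h1 h2).comp (by fun_prop)).sub continuous_const) |>.locallyIntegrableOn _)
        ?_ (by simp; linarith [hz.2]) ?_ (by simp; linarith [hz.1])
      · have h := rpow_neg_two_bound _ (coshQuot_isBigO_top t)
        have h2' : (fun x : ℝ => x ^ (-(2 : ℝ))) =O[atTop] fun x : ℝ => x ^ (-(0 : ℝ)) := by
          refine Asymptotics.IsBigO.of_bound 1 ?_
          filter_upwards [eventually_ge_atTop 1] with x hx
          rw [one_mul, Real.norm_of_nonneg (by positivity), Real.norm_of_nonneg (by positivity)]
          exact Real.rpow_le_rpow_of_exponent_le hx (by norm_num)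
        refine (h.trans h2').sub ?_
        simpa using Asymptotics.isBigO_const_const (coshQuot t 0) (one_ne_zero (α := ℝ)) atTop
      · have := (differentiableAt_coshQuot_comp h1 h2).isBigO_sub.mono
          (nhdsWithin_le_nhds (s := Ioi 0))
        simpa using this
    have hsub := hasMellin_sub hconv (hr.1.const_smul (coshQuot t 0))
    rw [mellin_const_smul, hr.2] at hsub
    have heq : (fun ξ : ℝ => coshQuot t (2 * Real.pi * ξ) - coshQuot t 0 -
        coshQuot t 0 • (1 / ((1 : ℂ) ^ 2 + (ξ : ℂ) ^ 2) - 1)) = coshQuotRegularized t := by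
      ext ξ; simp only [coshQuotRegularized, smul_eq_mul]; ring
    rw [heq] at hsub
    simp only [hsub.2, smul_eq_mul]
    have hcos : cos (Real.pi * z / 2) ≠ 0 := by
      have := cos_pi_half_ne_zero (k := z + 2) (by simp; linarith) (by simp; linarith [hz.2])
      rwa [show (Real.pi : ℂ) * (z + 2) / 2 = Real.pi * z / 2 + Real.pi by ring, cos_add_pi,
        neg_ne_zero] at this
    rw [mul_sub, mul_sub, hstrip]
    congr 1
    generalize cos (Real.pi * z / 2) = c at *
    field_simp

/-- The Mellin transform of `cosh x / (cos t + cosh 2x)`. -/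
lemma mellin_coshQuot (h1 : -Real.pi < t.re) (h2 : t.re < Real.pi) {k : ℂ} (hk : -1 < k.re) :
    (k + 1) * cos (Real.pi * k / 2) * (cos (t / 2) *
      (((2 * Real.pi : ℝ) : ℂ) ^ (-(k + 1)) * mellin (coshQuot t) (k + 1))) =
      -(∑ i, signCosh i * hurwitzEntire (-k) (hurwitzArg t i)) / 8 := by
  refine eqOn_of_eqOn_open (U := {z | -1 < z.re}) (V := {z | -1 < z.re ∧ z.re < 1})
    (f := fun k => (k + 1) * cos (Real.pi * k / 2) * (cos (t / 2) *
      (((2 * Real.pi : ℝ) : ℂ) ^ (-(k + 1)) * mellin (coshQuot t) (k + 1))))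
    (g := fun k => -(∑ i, signCosh i * hurwitzEntire (-k) (hurwitzArg t i)) / 8)
    (isOpen_re_gt _) (isPreconnected_re_gt _) ?_ ?_ (isOpen_re_strip _ _)
    (fun z hz => hz.1) ⟨0, by simp⟩ (fun z hz => ?_) hk
  · intro z hz
    have hm : DifferentiableAt ℂ (fun k => mellin (coshQuot t) (k + 1)) z :=
      (differentiableAt_mellin_coshQuot h1 h2 (s := z + 1)
        (by simp only [add_re, one_re]; linarith [mem_ofPred_eq ▸ hz])).comp z
        (f := fun k : ℂ => k + 1) (by fun_prop)
    have hp : DifferentiableAt ℂ (fun k : ℂ => ((2 * Real.pi : ℝ) : ℂ) ^ (-(k + 1))) z :=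
      DifferentiableAt.const_cpow (by fun_prop) (Or.inl two_pi_ne_zero')
    exact DifferentiableAt.differentiableWithinAt (by fun_prop)
  · have := differentiable_sum_signCosh h1 h2
    exact Differentiable.differentiableOn (by fun_prop)
  · simp only [← mellin_coshQuot_comp]
    -- For -1 < Re z < 1 the function 1/(1 + ξ²) has a Mellin transform itself, and adding its
    -- multiple back cancels the correction term exactly.
    have hreg := mellin_coshQuotRegularized h1 h2 (k := z) (by linarith [hz.1]) hz.2
    have hadd := hasMellin_add
      (mellinConvergent_coshQuotRegularized h1 h2 (k := z) (by linarith [hz.1]) hz.2)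
      ((mellinConvergent_one_div_sq_add_sq (A := 1) (k := z) (by simp) hz.1 hz.2).const_smul
        (coshQuot t 0))
    have heq : (fun ξ : ℝ => coshQuotRegularized t ξ +
        coshQuot t 0 • (1 / ((1 : ℂ) ^ 2 + (ξ : ℂ) ^ 2))) =
        fun ξ => coshQuot t (2 * Real.pi * ξ) := by
      ext ξ; simp only [coshQuotRegularized, smul_eq_mul]; ring
    rw [mellin_const_smul, mellin_one_div_one_add_sq hz.1 hz.2, heq] at hadd
    simp only [hadd.2, smul_eq_mul]
    have hcos := cos_pi_half_ne_zero hz.1 hz.2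
    rw [mul_add, mul_add, hreg]
    generalize cos (Real.pi * z / 2) = c at *
    field_simp
    ring

/-! ### Closed form for general k and its limits -/

/-- The Mellin transform of `sinh x sinh 2x / (cos t + cosh 2x) ^ 2`. -/
lemma mellin_sinhMulSinhQuot (h1 : -Real.pi < t.re) (h2 : t.re < Real.pi) (h0 : t ≠ 0) {k : ℂ}
    (hk : -3 < k.re) :
    k * (k + 1) * cos (Real.pi * k / 2) * (((2 * Real.pi : ℝ) : ℂ) ^ (-k) *
      mellin (sinhMulSinhQuot t) (k + 1)) =
      -(k * (k + 1) * (∑ i, signSinh i * hurwitzEntire (1 - k) (hurwitzArg t i)) /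
          (16 * sin (t / 2)) +
        k * (2 * Real.pi) * (∑ i, signCosh i * hurwitzEntire (-k) (hurwitzArg t i)) /
          (16 * cos (t / 2))) := by
  have hs := sin_half_ne_zero h1 h2 h0
  have hc := cos_half_ne_zero h1 h2
  -- With k, k + 1 and the cosine kept as factors, both sides are holomorphic on Re k > -3, while
  -- integration by parts is used only for Re k > 0.
  refine eqOn_of_eqOn_open (U := {z | -3 < z.re}) (V := {z | 0 < z.re})
    (f := fun k => k * (k + 1) * cos (Real.pi * k / 2) * (((2 * Real.pi : ℝ) : ℂ) ^ (-k) *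
      mellin (sinhMulSinhQuot t) (k + 1)))
    (g := fun k => -(k * (k + 1) * (∑ i, signSinh i * hurwitzEntire (1 - k) (hurwitzArg t i)) /
          (16 * sin (t / 2)) +
        k * (2 * Real.pi) * (∑ i, signCosh i * hurwitzEntire (-k) (hurwitzArg t i)) /
          (16 * cos (t / 2))))
    (isOpen_re_gt _) (isPreconnected_re_gt _) ?_ ?_ (isOpen_re_gt _)
    (fun z hz => ?_) ⟨1, by simp⟩ (fun z hz => ?_) hk
  · intro z hz
    have hm : DifferentiableAt ℂ (fun k => mellin (sinhMulSinhQuot t) (k + 1)) z :=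
      (differentiableAt_mellin_sinhMulSinhQuot h1 h2 (s := z + 1)
        (by simp only [add_re, one_re]; linarith [mem_ofPred_eq ▸ hz])).comp z
        (f := fun k : ℂ => k + 1) (by fun_prop)
    have hp : DifferentiableAt ℂ (fun k : ℂ => ((2 * Real.pi : ℝ) : ℂ) ^ (-k)) z :=
      DifferentiableAt.const_cpow (by fun_prop) (Or.inl two_pi_ne_zero')
    exact DifferentiableAt.differentiableWithinAt (by fun_prop)
  · have d1 := differentiable_sum_signCosh h1 h2
    have d2 : Differentiable ℂ fun k => ∑ i, signSinh i * hurwitzEntire (1 - k) (hurwitzArg t i) :=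
      (differentiable_sum_hurwitzEntire h1 h2 signSinh).comp (f := fun k : ℂ => 1 - k) (by fun_prop)
    exact Differentiable.differentiableOn (by fun_prop)
  · simp only [mem_ofPred_eq] at hz ⊢; linarith
  · have hz' : 0 < z.re := hz
    have hA := mellin_sinhQuot h1 h2 (k := z) (by linarith)
    have hB := mellin_coshQuot h1 h2 (k := z) (by linarith)
    simp only [mellin_sinhMulSinhQuot_eq h1 h2 hz']
    have hp : ((2 * Real.pi : ℝ) : ℂ) ^ (-z) =
        (2 * Real.pi) * ((2 * Real.pi : ℝ) : ℂ) ^ (-(z + 1)) := by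
      rw [neg_add, cpow_add _ _ two_pi_ne_zero', cpow_neg_one]
      have := two_pi_ne_zero'
      have hpi : (Real.pi : ℂ) ≠ 0 := ofReal_ne_zero.2 Real.pi_ne_zero
      push_cast
      field_simp
    have hA' : z * cos (Real.pi * z / 2) * (((2 * Real.pi : ℝ) : ℂ) ^ (-z) * mellin (sinhQuot t) z) =
        -(∑ i, signSinh i * hurwitzEntire (1 - z) (hurwitzArg t i)) / 8 / sin (t / 2) := by
      rw [eq_div_iff hs, ← hA]; ring
    have hB' : (z + 1) * cos (Real.pi * z / 2) *
        (((2 * Real.pi : ℝ) : ℂ) ^ (-(z + 1)) * mellin (coshQuot t) (z + 1)) =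
        -(∑ i, signCosh i * hurwitzEntire (-z) (hurwitzArg t i)) / 8 / cos (t / 2) := by
      rw [eq_div_iff hc, ← hB]; ring
    have e : ∀ a b c : ℂ, a / (16 * b) = a / 8 / b / 2 := fun a b _ => by
      rw [div_div, div_div]; congr 1; ring
    rw [e _ _ 0, e _ _ 0]
    linear_combination z * (z + 1) / 2 * hA' + z * Real.pi * hB' + z * (z + 1) *
      cos (Real.pi * z / 2) * mellin (coshQuot t) (z + 1) / 2 * hp

end

section

variable {t : ℂ}

lemma exp_pi_mul_I_mul_half_sq (k : ℂ) : exp (I * Real.pi * k / 2) ^ 2 = (-1 : ℂ) ^ k := by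
  rw [← exp_nat_mul, cpow_def_of_ne_zero (by norm_num), log_neg_one]
  congr 1; push_cast; ring

/-- `e^{iπk/2} / ((-1)^k + 1) = 1 / (2 cos (πk/2))` -/
lemma neg_one_cpow_add_one (k : ℂ) :
    (-1 : ℂ) ^ k + 1 = exp (I * Real.pi * k / 2) * (2 * cos (Real.pi * k / 2)) := by
  rw [← exp_pi_mul_I_mul_half_sq, two_cos, mul_add, ← exp_add, ← exp_add, ← exp_nat_mul,
    ← exp_zero]
  congr 2 <;> push_cast <;> ring

lemma cos_pi_half_ne_zero_of_not_odd {k : ℂ} (hk : ∀ n : ℤ, k ≠ 2 * (n : ℂ) + 1) :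
    cos (Real.pi * k / 2) ≠ 0 := by
  rw [Ne, cos_eq_zero_iff]
  rintro ⟨n, hn⟩
  refine hk n ?_
  have hpi : (Real.pi : ℂ) ≠ 0 := ofReal_ne_zero.2 Real.pi_ne_zero
  field_simp at hn
  exact hn

lemma hurwitzSide_eq (k t : ℂ) : hurwitzSide k t =
    2 ^ (k - 3) * exp (I * Real.pi * k / 2) * k * (Real.pi : ℂ) ^ k
      / (sin (t / 2) * ((-1 : ℂ) ^ k + 1)) * (∑ i, signSinh i * hurwitzZ (1 - k) (hurwitzArg t i)) +
    2 ^ (k - 2) * exp (I * Real.pi * k / 2) * (Real.pi : ℂ) ^ (k + 1)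
      / (cos (t / 2) * ((-1 : ℂ) ^ k + 1)) * (∑ i, signCosh i * hurwitzZ (-k) (hurwitzArg t i)) := by
  rw [hurwitzSide]
  simp only [Fin.sum_univ_four, signSinh, signCosh, hurwitzArg, Matrix.cons_val]
  ring

lemma sum_hurwitzZ (h1 : -Real.pi < t.re) (h2 : t.re < Real.pi) (ε : Fin 4 → ℂ) {s : ℂ}
    (hs : s ≠ 1) : ∑ i, ε i * hurwitzZ s (hurwitzArg t i) =
      (∑ i, ε i * hurwitzEntire s (hurwitzArg t i)) / (s - 1) := by
  rw [Finset.sum_div]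
  refine Finset.sum_congr rfl fun i _ => ?_
  rw [hurwitzZ_eq (hurwitzArg_re_pos h1 h2 i) hs, mul_div_assoc]

/-- The entire functions are -k ζ(1 - k, a) and -(k + 1) ζ(-k, a). The hypotheses on k are what is
needed to divide by k, k + 1 and cos(πk/2), the value k = -1 being odd. -/
theorem integral_hypIntegrand_eq (h1 : -Real.pi < t.re) (h2 : t.re < Real.pi) (h0 : t ≠ 0) {k : ℂ}
    (hk : -3 < k.re) (hk0 : k ≠ 0) (hodd : ∀ n : ℤ, k ≠ 2 * (n : ℂ) + 1) :
    ∫ x in Ioi (0 : ℝ), hypIntegrand k t x = hurwitzSide k t := by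
  have hk1 : k + 1 ≠ 0 := fun h => hodd (-1) (by push_cast; linear_combination h)
  have hs := sin_half_ne_zero h1 h2 h0
  have hc := cos_half_ne_zero h1 h2
  have hcos := cos_pi_half_ne_zero_of_not_odd hodd
  have hM := mellin_sinhMulSinhQuot h1 h2 h0 hk
  have hpi : (Real.pi : ℂ) ≠ 0 := ofReal_ne_zero.2 Real.pi_ne_zero
  rw [integral_hypIntegrand, hurwitzSide_eq, neg_one_cpow_add_one,
    sum_hurwitzZ h1 h2 _ (by simpa [sub_eq_self] using hk0),
    sum_hurwitzZ h1 h2 _ (fun h => hk1 (by linear_combination -h))]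
  have hp : ((2 * Real.pi : ℝ) : ℂ) ^ (-k) = ((2 : ℂ) ^ k * (Real.pi : ℂ) ^ k)⁻¹ := by
    have h := mul_cpow_ofReal_nonneg two_pos.le Real.pi_pos.le k
    rw [cpow_neg, ofReal_mul, h]
    simp
  have h3 : (2 : ℂ) ^ (k - 3) = 2 ^ k / 8 := by
    rw [cpow_sub _ _ two_ne_zero, cpow_ofNat]; norm_num
  have h4 : (2 : ℂ) ^ (k - 2) = 2 ^ k / 4 := by
    rw [cpow_sub _ _ two_ne_zero, cpow_ofNat]; norm_num
  have h5 : (Real.pi : ℂ) ^ (k + 1) = (Real.pi : ℂ) ^ k * Real.pi := by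
    rw [cpow_add _ _ hpi, cpow_one]
  have e1 : (1 : ℂ) - k - 1 = -k := by ring
  have e2 : (-k : ℂ) - 1 = -(k + 1) := by ring
  have h2k : (2 : ℂ) ^ k ≠ 0 := by simp [cpow_eq_zero_iff]
  have hpk : (Real.pi : ℂ) ^ k ≠ 0 := by simp [cpow_eq_zero_iff, hpi]
  have he := exp_ne_zero (I * Real.pi * k / 2)
  rw [h3, h4, h5, e1, e2]
  rw [hp] at hM
  generalize mellin (sinhMulSinhQuot t) (k + 1) = M at *
  generalize ∑ i, signSinh i * hurwitzEntire (1 - k) (hurwitzArg t i) = S at *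
  generalize ∑ i, signCosh i * hurwitzEntire (-k) (hurwitzArg t i) = T at *
  generalize exp (I * Real.pi * k / 2) = E at *
  generalize cos (Real.pi * k / 2) = c at *
  generalize (2 : ℂ) ^ k = a at *
  generalize (Real.pi : ℂ) ^ k = b at *
  generalize sin (t / 2) = u at *
  generalize cos (t / 2) = v at *
  have hM' : M = -(k * (k + 1) * S / (16 * u) + k * (2 * Real.pi) * T / (16 * v)) * (a * b) /
      (k * (k + 1) * c) := by
    rw [eq_div_iff (by simp [hk0, hk1, hcos]), ← hM]
    field_simp
  rw [hM']
  field_simp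
  ring

lemma integrableOn_hypIntegrand (h1 : -Real.pi < t.re) (h2 : t.re < Real.pi) {k : ℂ}
    (hk : -3 < k.re) : IntegrableOn (hypIntegrand k t) (Ioi 0) := by
  have h : IntegrableOn (fun x : ℝ => (x : ℂ) ^ (k + 1 - 1) • sinhMulSinhQuot t x) (Ioi 0) :=
    mellinConvergent_sinhMulSinhQuot h1 h2 (s := k + 1) (by simp; linarith)
  refine h.congr_fun (fun x _ => ?_) measurableSet_Ioi
  simp only [hypIntegrand, sinhMulSinhQuot, add_sub_cancel_right, smul_eq_mul]
  ring

/-- Odd integers are zeros of cos(πk/2), a nonzero entire function, so they are isolated. -/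
lemma eventually_ne_odd (k₀ : ℂ) : ∀ᶠ k in 𝓝[≠] k₀, ∀ n : ℤ, k ≠ 2 * (n : ℂ) + 1 := by
  have h : ∀ᶠ k in 𝓝[≠] k₀, cos (Real.pi * k / 2) ≠ 0 := by
    have han : AnalyticAt ℂ (fun k : ℂ => cos (Real.pi * k / 2)) k₀ :=
      (Differentiable.differentiableOn (s := univ) (by fun_prop)).analyticAt univ_mem
    rcases han.eventually_eq_zero_or_eventually_ne_zero with h | h
    · exfalso
      have hd : Differentiable ℂ (fun k : ℂ => cos (Real.pi * k / 2)) := by fun_prop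
      have := (hd.differentiableOn.analyticOnNhd isOpen_univ).eqOn_zero_of_preconnected_of_eventuallyEq_zero
        isPreconnected_univ (mem_univ k₀) h (mem_univ 0)
      simp at this
    · exact h
  filter_upwards [h] with k hk n hn
  apply hk
  rw [cos_eq_zero_iff]
  exact ⟨n, by rw [hn]; ring⟩

/-- The Mellin transform is continuous at k₀ and equals the closed form on a punctured
neighbourhood; the value of `hurwitzSide` at k₀ itself, possibly a default one, plays no role. -/
lemma tendsto_hurwitzSide (h1 : -Real.pi < t.re) (h2 : t.re < Real.pi) (h0 : t ≠ 0) {k₀ : ℂ}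
    (hk : -3 < k₀.re) : Tendsto (fun k => hurwitzSide k t) (𝓝[≠] k₀)
      (𝓝 (∫ x in Ioi (0 : ℝ), hypIntegrand k₀ t x)) := by
  have hcont : ContinuousAt (fun k => mellin (sinhMulSinhQuot t) (k + 1)) k₀ :=
    ((differentiableAt_mellin_sinhMulSinhQuot h1 h2 (s := k₀ + 1) (by simp; linarith)).comp k₀
      (f := fun k : ℂ => k + 1) (by fun_prop)).continuousAt
  rw [integral_hypIntegrand]
  refine Tendsto.congr' ?_ (hcont.tendsto.mono_left nhdsWithin_le_nhds)
  have hz : ∀ᶠ k : ℂ in 𝓝[≠] k₀, k ≠ 0 := by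
    by_cases h : k₀ = 0
    · rw [h]; exact self_mem_nhdsWithin
    · exact mem_nhdsWithin_of_mem_nhds (isOpen_ne.mem_nhds h)
  filter_upwards [eventually_ne_odd k₀, hz,
    mem_nhdsWithin_of_mem_nhds ((isOpen_re_gt (-3)).mem_nhds hk)] with k hodd hk0 hk3
  rw [← integral_hypIntegrand, integral_hypIntegrand_eq h1 h2 h0 hk3 hk0 hodd]

/-! ### The case k = 1 -/

/-- The value at `k = 1` of the Mellin transform of `cosh x / (cos t + cosh 2x)`, as a derivative. -/
lemma mellin_coshQuot_two (h1 : -Real.pi < t.re) (h2 : t.re < Real.pi) :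
    mellin (coshQuot t) 2 =
      Real.pi / cos (t / 2) * ∑ i, signCosh i * hurwitzZDeriv (-1) (hurwitzArg t i) := by
  have hpi : (Real.pi : ℂ) ≠ 0 := ofReal_ne_zero.2 Real.pi_ne_zero
  have hc := cos_half_ne_zero h1 h2
  set J : ℂ → ℂ := fun k => cos (t / 2) *
    (((2 * Real.pi : ℝ) : ℂ) ^ (-(k + 1)) * mellin (coshQuot t) (k + 1)) with hJ
  have hJd : DifferentiableAt ℂ J 1 := by
    have hm : DifferentiableAt ℂ (fun k => mellin (coshQuot t) (k + 1)) 1 :=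
      (differentiableAt_mellin_coshQuot h1 h2 (s := 1 + 1) (by simp)).comp (1 : ℂ)
        (f := fun k : ℂ => k + 1) (by fun_prop)
    have hp : DifferentiableAt ℂ (fun k : ℂ => ((2 * Real.pi : ℝ) : ℂ) ^ (-(k + 1))) 1 :=
      DifferentiableAt.const_cpow (by fun_prop) (Or.inl two_pi_ne_zero')
    fun_prop
  have hcos1 : cos (Real.pi * 1 / 2) = 0 := by rw [mul_one]; exact cos_pi_div_two
  -- The cosine vanishes at 1, so the product rule leaves only its derivative times J(1); comparing
  -- derivatives of both sides thus recovers J(1) from ζ'.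
  have hL : HasDerivAt (fun k : ℂ => cos (Real.pi * k / 2) * J k) (-(Real.pi / 2) * J 1) 1 := by
    have hcd : HasDerivAt (fun k : ℂ => cos (Real.pi * k / 2)) (-(Real.pi / 2)) 1 := by
      have := (((hasDerivAt_id (1 : ℂ)).const_mul (Real.pi : ℂ)).div_const 2).ccos
      simpa [sin_pi_div_two] using this
    have := hcd.mul hJd.hasDerivAt
    rw [hcos1, zero_mul, add_zero] at this
    exact this
  have hZd : ∀ i, HasDerivAt (fun k : ℂ => hurwitzZ (-k) (hurwitzArg t i))
      (-hurwitzZDeriv (-1) (hurwitzArg t i)) 1 := by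
    intro i
    have ha := hurwitzArg_re_pos h1 h2 i
    have hd : DifferentiableAt ℂ (fun z => hurwitzZ z (hurwitzArg t i)) (-1) := by
      have hne : (-1 : ℂ) ≠ 1 := by norm_num
      have : DifferentiableAt ℂ (fun s => hurwitzEntire s (hurwitzArg t i) / (s - 1)) (-1) :=
        (differentiable_hurwitzEntire ha _).div (by fun_prop) (sub_ne_zero.2 hne)
      refine this.congr_of_eventuallyEq ?_
      filter_upwards [isOpen_ne.mem_nhds hne] with s hs
      exact hurwitzZ_eq ha hs
    have := HasDerivAt.comp (1 : ℂ) (h := fun k : ℂ => -k)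
      (h₂ := fun z => hurwitzZ z (hurwitzArg t i)) hd.hasDerivAt (hasDerivAt_neg 1)
    simpa [hurwitzZDeriv, Function.comp_def] using this
  have hR : HasDerivAt (fun k : ℂ => (∑ i, signCosh i * hurwitzZ (-k) (hurwitzArg t i)) / 8)
      ((∑ i, signCosh i * -hurwitzZDeriv (-1) (hurwitzArg t i)) / 8) 1 :=
    (HasDerivAt.fun_sum fun i _ => (hZd i).const_mul _).div_const 8
  have heq : (fun k : ℂ => cos (Real.pi * k / 2) * J k) =ᶠ[𝓝 1]
      fun k : ℂ => (∑ i, signCosh i * hurwitzZ (-k) (hurwitzArg t i)) / 8 := by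
    filter_upwards [(isOpen_re_gt (-1)).mem_nhds (show (1 : ℂ) ∈ {z : ℂ | -1 < z.re} by simp)]
      with k hk
    have hk' : -1 < k.re := hk
    have hk1 : k + 1 ≠ 0 := ne_zero_of_re_pos (by simp only [add_re, one_re]; linarith)
    have hB := mellin_coshQuot h1 h2 (k := k) hk
    rw [sum_hurwitzZ h1 h2 _ (fun h => hk1 (by linear_combination -h)),
      show (-k : ℂ) - 1 = -(k + 1) by ring, div_neg, ← mul_right_inj' hk1, ← mul_assoc]
    simp only [hJ]
    rw [hB]
    field_simp
  have hder := (hL.congr_of_eventuallyEq heq.symm).unique hR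
  simp only [mul_neg, Finset.sum_neg_distrib] at hder
  have hJ1 : J 1 = cos (t / 2) * (mellin (coshQuot t) 2 / (2 * Real.pi) ^ 2) := by
    simp only [hJ]
    rw [show (1 : ℂ) + 1 = 2 by norm_num, cpow_neg, cpow_ofNat]
    push_cast; ring
  rw [hJ1] at hder
  generalize ∑ i, signCosh i * hurwitzZDeriv (-1) (hurwitzArg t i) = S at *
  field_simp at hder ⊢
  linear_combination -hder / 8

end

section

variable {t : ℂ}

lemma sin_half_re_im (t : ℂ) : (sin (t / 2)).im = Real.cos (t.re / 2) * Real.sinh (t.im / 2) ∧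
    (t.im = 0 → (sin (t / 2)).re = Real.sin (t.re / 2)) := by
  have him : (t / 2).im = t.im / 2 := by
    rw [show (2 : ℂ) = ((2 : ℝ) : ℂ) by norm_cast, div_ofReal_im]
  have e : sin (t / 2) = ((Real.sin (t.re / 2) * Real.cosh (t.im / 2) : ℝ) : ℂ) +
      ((Real.cos (t.re / 2) * Real.sinh (t.im / 2) : ℝ) : ℂ) * I := by
    rw [sin_eq, half_re, him]; push_cast; rfl
  refine ⟨by rw [e, add_im, ofReal_im, im_ofReal_mul, I_im]; ring, fun h => ?_⟩
  rw [e, add_re, ofReal_re, re_ofReal_mul, I_re, h]; simp only [zero_div, Real.cosh_zero]; ring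

/-- For real t, |sin(t/2)| < 1 ≤ cosh x. Otherwise Im sin(t/2) = cos(Re t/2) sinh(Im t/2) is
nonzero. -/
lemma cosh_add_mem_slitPlane (h1 : -Real.pi < t.re) (h2 : t.re < Real.pi) (x : ℝ) {σ : ℝ}
    (hσ : |σ| = 1) : cosh x + σ * sin (t / 2) ∈ slitPlane := by
  have hc : cosh (x : ℂ) = ((Real.cosh x : ℝ) : ℂ) := by push_cast; rfl
  obtain ⟨him, hre⟩ := sin_half_re_im t
  have hcos : 0 < Real.cos (t.re / 2) :=
    Real.cos_pos_of_mem_Ioo ⟨by linarith, by linarith⟩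
  have hσ0 : σ ≠ 0 := by rintro rfl; simp at hσ
  by_cases h : t.im = 0
  · left
    rw [add_re, re_ofReal_mul, hc, ofReal_re, hre h]
    have h3 := Real.one_le_cosh x
    have h4 : |σ * Real.sin (t.re / 2)| < 1 := by
      rw [abs_mul, hσ, one_mul]
      refine (sq_lt_one_iff_abs_lt_one _).1 ?_
      nlinarith [Real.sin_sq_add_cos_sq (t.re / 2)]
    linarith [(abs_lt.1 h4).1]
  · right
    rw [add_im, im_ofReal_mul, hc, ofReal_im, him, zero_add]
    refine mul_ne_zero hσ0 (mul_ne_zero hcos.ne' ?_)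
    rw [Ne, Real.sinh_eq_zero]
    intro h'; apply h; linarith

/-- Comparison with a real logarithm shows that the two logarithms in the primitive cancel at
infinity, with no leftover multiple of 2πi. -/
lemma tendsto_log_cosh_add (c : ℂ) :
    Tendsto (fun x : ℝ => log (cosh x + c) - ((Real.log (Real.cosh x) : ℝ) : ℂ)) atTop (𝓝 0) := by
  have hcosh : Tendsto (fun x : ℝ => Real.cosh x) atTop atTop := by
    refine tendsto_atTop_mono (fun x => ?_) (Real.tendsto_exp_atTop.atTop_div_const two_pos)
    rw [Real.cosh_eq]; linarith [Real.exp_pos (-x)]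
  have h1 : Tendsto (fun x : ℝ => 1 + c / ((Real.cosh x : ℝ) : ℂ)) atTop (𝓝 1) := by
    have h := (tendsto_inv_atTop_zero.comp hcosh)
    have h' := ((continuous_ofReal.tendsto 0).comp h).const_mul c
    have := h'.const_add 1
    simpa [Function.comp_def, div_eq_mul_inv] using this
  have h2 : Tendsto (fun x : ℝ => log (1 + c / ((Real.cosh x : ℝ) : ℂ))) atTop (𝓝 0) := by
    have := (continuousAt_clog (x := 1) (by simp)).tendsto.comp h1
    simpa only [log_one, Function.comp_def] using this
  refine h2.congr' ?_
  filter_upwards [h1.eventually_ne one_ne_zero] with x hx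
  have hp := Real.cosh_pos x
  have e : cosh (x : ℂ) + c = ((Real.cosh x : ℝ) : ℂ) * (1 + c / ((Real.cosh x : ℝ) : ℂ)) := by
    rw [mul_add, mul_div_cancel₀ _ (ofReal_ne_zero.2 hp.ne')]; push_cast; ring
  rw [e, log_ofReal_mul hp hx]
  ring

/-- With p = (t + π)/4 one has 1 ± sin(t/2) = 2 sin² p, 2 cos² p. Both sin p and cos p have positive
real part, so principal logarithms of the squares and of the quotient split. -/
lemma log_one_add_sin_sub (h1 : -Real.pi < t.re) (h2 : t.re < Real.pi) :
    log (1 + sin (t / 2)) - log (1 - sin (t / 2)) = 2 * log (tan ((t + Real.pi) / 4)) := by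
  set p : ℂ := (t + Real.pi) / 4 with hp
  have hpre : p.re = (t.re + Real.pi) / 4 := by
    rw [hp, show (4 : ℂ) = ((4 : ℝ) : ℂ) by norm_cast, div_ofReal_re]; simp
  have hs : 0 < (sin p).re := by
    have e : (sin p).re = Real.sin p.re * Real.cosh p.im := by
      rw [sin_eq, ← ofReal_sin, ← ofReal_cosh, ← ofReal_cos, ← ofReal_sinh]
      simp [-ofReal_sin, -ofReal_cosh, -ofReal_cos, -ofReal_sinh]
    rw [e, hpre]
    exact mul_pos (Real.sin_pos_of_mem_Ioo ⟨by linarith, by linarith⟩) (Real.cosh_pos _)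
  have hc : 0 < (cos p).re := by
    have e : (cos p).re = Real.cos p.re * Real.cosh p.im := by
      rw [cos_eq, ← ofReal_sin, ← ofReal_cosh, ← ofReal_cos, ← ofReal_sinh]
      simp [-ofReal_sin, -ofReal_cosh, -ofReal_cos, -ofReal_sinh]
    rw [e, hpre]
    exact mul_pos (Real.cos_pos_of_mem_Ioo ⟨by linarith, by linarith⟩) (Real.cosh_pos _)
  have hs2 : sin (t / 2) = -cos (2 * p) := by
    rw [show 2 * p = t / 2 + Real.pi / 2 by rw [hp]; ring, cos_add_pi_div_two, neg_neg]
  have e1 : 1 + sin (t / 2) = ((2 : ℝ) : ℂ) * sin p ^ 2 := by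
    rw [hs2, cos_two_mul]; push_cast; linear_combination -2 * sin_sq_add_cos_sq p
  have e2 : 1 - sin (t / 2) = ((2 : ℝ) : ℂ) * cos p ^ 2 := by
    rw [hs2, cos_two_mul]; push_cast; ring
  have harg : ∀ z : ℂ, 0 < z.re → -(Real.pi / 2) < z.arg ∧ z.arg < Real.pi / 2 := fun z hz =>
    abs_lt.1 (abs_arg_lt_pi_div_two_iff.2 (Or.inl hz))
  have hlogsq : ∀ z : ℂ, 0 < z.re → log (z ^ 2) = 2 * log z := fun z hz => by
    have h := harg z hz
    have hz0 := ne_zero_of_re_pos hz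
    rw [sq, log_mul hz0 hz0 ⟨by linarith [h.1], by linarith [h.2]⟩]
    ring
  have hs0 := ne_zero_of_re_pos hs
  have hc0 := ne_zero_of_re_pos hc
  have hdiv : log (sin p / cos p) = log (sin p) - log (cos p) := by
    have a1 := harg _ hs
    have a2 := harg _ hc
    have h3 := arg_ne_pi_of_re_pos hc
    rw [div_eq_mul_inv, log_mul hs0 (inv_ne_zero hc0) ?_, log_inv _ h3, sub_eq_add_neg]
    rw [arg_inv, if_neg h3]
    exact ⟨by linarith [a1.1, a2.2], by linarith [a1.2, a2.1]⟩
  rw [e1, e2, log_ofReal_mul two_pos (pow_ne_zero 2 hs0), log_ofReal_mul two_pos (pow_ne_zero 2 hc0),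
    hlogsq _ hs, hlogsq _ hc, tan_eq_sin_div_cos, hdiv]
  ring

/-- With c = sin(t/2) the denominator is 2(cosh² x - c²), so partial fractions in cosh x give a
logarithmic primitive. -/
lemma mellin_sinhQuot_one (h1 : -Real.pi < t.re) (h2 : t.re < Real.pi) (h0 : t ≠ 0) :
    mellin (sinhQuot t) 1 = 1 / (2 * sin (t / 2)) * log (tan ((t + Real.pi) / 4)) := by
  have hs := sin_half_ne_zero h1 h2 h0
  set c := sin (t / 2) with hc
  set f : ℝ → ℂ := fun x => 1 / (4 * c) * (log (cosh x + ((-1 : ℝ) : ℂ) * c) -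
    log (cosh x + ((1 : ℝ) : ℂ) * c)) with hf
  have hm1 := fun x => cosh_add_mem_slitPlane h1 h2 x (σ := -1) (by simp)
  have hm2 := fun x => cosh_add_mem_slitPlane h1 h2 x (σ := 1) (by simp)
  have hderiv : ∀ x ∈ Ici (0 : ℝ), HasDerivAt f (sinhQuot t x) x := by
    intro x _
    have d : ∀ b : ℂ, HasDerivAt (fun y : ℝ => cosh (y : ℂ) + b) (sinh (x : ℂ)) x := fun b =>
      ((hasDerivAt_cosh (x : ℂ)).add_const b).comp_ofReal
    have := (((d _).clog_real (hm1 x)).sub ((d _).clog_real (hm2 x))).const_mul (1 / (4 * c))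
    convert! this using 1
    have n1 := slitPlane_ne_zero (hm1 x)
    have n2 := slitPlane_ne_zero (hm2 x)
    rw [← hc] at n1 n2
    have hD : cos t + cosh (2 * x) = 2 * (cosh x + ((-1 : ℝ) : ℂ) * c) *
        (cosh x + ((1 : ℝ) : ℂ) * c) := by
      have e1 : cos t = 1 - 2 * c ^ 2 := by
        have := cos_two_mul (t / 2)
        rw [show 2 * (t / 2) = t by ring] at this
        rw [this, hc]; linear_combination 2 * sin_sq_add_cos_sq (t / 2)
      rw [e1, cosh_two_mul]; push_cast
      linear_combination -cosh_sq (x : ℂ)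
    rw [sinhQuot, hD, div_sub_div _ _ n1 n2]
    push_cast at n1 n2 ⊢
    field_simp
    ring
  have hlim : Tendsto f atTop (𝓝 0) := by
    have := (((tendsto_log_cosh_add (((-1 : ℝ) : ℂ) * c)).sub
      (tendsto_log_cosh_add (((1 : ℝ) : ℂ) * c))).const_mul (1 / (4 * c)))
    simpa [hf] using this
  have hint : IntegrableOn (sinhQuot t) (Ioi 0) := by
    have h : IntegrableOn (fun x : ℝ => (x : ℂ) ^ ((1 : ℂ) - 1) • sinhQuot t x) (Ioi 0) :=
      mellinConvergent_sinhQuot h1 h2 (s := 1) (by simp)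
    simpa using h
  have h := integral_Ioi_of_hasDerivAt_of_tendsto' hderiv hint hlim
  have hmell : mellin (sinhQuot t) 1 = ∫ x in Ioi (0 : ℝ), sinhQuot t x := by simp [mellin]
  have hlog := log_one_add_sin_sub h1 h2
  rw [← hc] at hlog
  rw [hmell, h]
  simp only [hf]
  push_cast
  rw [cosh_zero, one_mul, neg_one_mul, ← sub_eq_add_neg]
  have e : log (1 - c) - log (1 + c) = -(2 * log (tan ((t + Real.pi) / 4))) := by
    rw [← hlog]; ring
  rw [e]
  field_simp
  ring

end

theorem mainTheorem6 (t : ℂ) (ht₁ : -Real.pi < t.re) (ht₂ : t.re < Real.pi) (ht₀ : t ≠ 0) :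
    (∀ k : ℂ, -3 < k.re → IntegrableOn (hypIntegrand k t) (Ioi 0)) ∧
    (∀ k : ℂ, -3 < k.re → k ≠ 0 → (∀ n : ℤ, k ≠ 2 * (n : ℂ) + 1) →
      ∫ x in Ioi (0 : ℝ), hypIntegrand k t x = hurwitzSide k t) ∧
    (∀ k₀ : ℂ, -3 < k₀.re →
      Tendsto (fun k : ℂ => hurwitzSide k t) (𝓝[≠] k₀)
        (𝓝 (∫ x in Ioi (0 : ℝ), hypIntegrand k₀ t x))) ∧
    ∫ x in Ioi (0 : ℝ),
        (x : ℂ) * sinh (x : ℂ) * sinh (2 * (x : ℂ)) / (cos t + cosh (2 * (x : ℂ))) ^ 2 =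
      Real.pi / (2 * cos (t / 2)) *
          (hurwitzZDeriv (-1) ((Real.pi - t) / (4 * Real.pi))
            + hurwitzZDeriv (-1) ((t + Real.pi) / (4 * Real.pi))
            - hurwitzZDeriv (-1) (3 / 4 - t / (4 * Real.pi))
            - hurwitzZDeriv (-1) (1 / 4 * (t / Real.pi + 3)))
        + 1 / (4 * sin (t / 2)) * log (tan ((t + Real.pi) / 4)) := by
  refine ⟨fun k hk => integrableOn_hypIntegrand ht₁ ht₂ hk,
    fun k hk hk0 hodd => integral_hypIntegrand_eq ht₁ ht₂ ht₀ hk hk0 hodd,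
    fun k₀ hk => tendsto_hurwitzSide ht₁ ht₂ ht₀ hk, ?_⟩
  -- Integration by parts holds at k = 1 itself: the sinh half supplies log tan and the cosh half
  -- the ζ' terms, without taking a limit of the closed form.
  have h : ∫ x in Ioi (0 : ℝ),
      (x : ℂ) * sinh (x : ℂ) * sinh (2 * (x : ℂ)) / (cos t + cosh (2 * (x : ℂ))) ^ 2 =
      mellin (sinhMulSinhQuot t) (1 + 1) := by
    rw [← integral_hypIntegrand]
    simp only [hypIntegrand, cpow_one]
  rw [h, mellin_sinhMulSinhQuot_eq ht₁ ht₂ (by simp), mellin_sinhQuot_one ht₁ ht₂ ht₀,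
    one_add_one_eq_two, mellin_coshQuot_two ht₁ ht₂]
  have hs := sin_half_ne_zero ht₁ ht₂ ht₀
  have hc := cos_half_ne_zero ht₁ ht₂
  simp only [Fin.sum_univ_four, signCosh, hurwitzArg, Matrix.cons_val]
  field_simp
  ring
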